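/- Let $n\ge 2$, let $\Omega\subset\mathbb R^2$ be a bounded simply connected domain with smooth ($C^\infty$) boundary, and let $g_1,\dots,g_n:\partial\Omega\to S^1=\{z\in\mathbb C:|z|=1\}$ be smooth maps (of arbitrary degree). Write $H^1_{g_j}=\{u\in H^1(\Omega;\mathbb C): u=g_j\text{ on }\partial\Omega\}$, where the boundary condition means that $u-G\in H^1_0(\Omega;\mathbb C)$ for a smooth extension $G$ of $g_j$ to $\mathbb R^2$. For $\varepsilon>0$ let $$E_\varepsilon(u_1,\dots,u_n)=\frac12\int_\Omega\sum_{j=1}^n|\nabla u_j|^2\,dx+\frac1{4\varepsilon^2}\int_\Omega\Big(n-\sum_{j=1}^n|u_j|^2\Big)^2dx ,\qquad I(u_1,\dots,u_n)=\sum_{j=1}^n\int_\Omega|\nabla u_j|^2\,dx,$$ and let $$\mathcal X(g_1,\dots,g_n)=\Big\{(u_1,\dots,u_n)\in H^1_{g_1}\times\cdots\times H^1_{g_n}:\ \sum_{j=1}^n|u_j|^2=n\ \text{ a.e. on }\Omega\Big\}.$$ For every $\varepsilon>0$ let $(u_{1,\varepsilon},\dots,u_{n,\varepsilon})$ be a minimizer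 of $E_\varepsilon$ over $H^1_{g_1}\times\cdots\times H^1_{g_n}$. Then: 1. every sequence $\varepsilon_k>0$ with $\varepsilon_k\to0$ has a subsequence along which $(u_{1,\varepsilon_k},\dots,u_{n,\varepsilon_k})$ converges strongly in $H^1(\Omega;\mathbb C)^n$ to some $(u_1^*,\dots,u_n^*)\in\mathcal X(g_1,\dots,g_n)$ which minimizes $I$ over $\mathcal X(g_1,\dots,g_n)$; 2. $$\lim_{\varepsilon\to0^+}\frac1{\varepsilon^2}\int_\Omega\Big(n-\sum_{j=1}^n|u_{j,\varepsilon}|^2\Big)^2dx=0 .$$ -/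

import Mathlib

open MeasureTheory Filter Topology Set
open scoped ContDiff ENNReal

namespace GinzburgLandau

/-- The plane `ℝ²` with its Euclidean structure. -/
abbrev Plane : Type := EuclideanSpace ℝ (Fin 2)

/-- The `i`-th partial derivative of a function on the plane. -/
noncomputable def partialDeriv {F : Type*} [NormedAddCommGroup F] [NormedSpace ℝ F]
    (i : Fin 2) (φ : Plane → F) (x : Plane) : F :=
  fderiv ℝ φ x (EuclideanSpace.single i 1)

/-- `φ` is a test function on `Ω`: smooth, with compact support contained in `Ω`. -/
structure IsTestFunction {F : Type*} [NormedAddCommGroup F] [NormedSpace ℝ F]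
    (Ω : Set Plane) (φ : Plane → F) : Prop where
  contDiff : ContDiff ℝ ∞ φ
  hasCompactSupport : HasCompactSupport φ
  tsupport_subset : tsupport φ ⊆ Ω

/-- The boundary of `Ω` is smooth and `Ω` lies locally on one side of it: near every boundary point
`Ω` is the sublevel set `{ρ < 0}` of a smooth function `ρ` whose differential does not vanish at
that point. -/
def HasSmoothBoundary (Ω : Set Plane) : Prop :=
  ∀ p ∈ frontier Ω, ∃ U : Set Plane, IsOpen U ∧ p ∈ U ∧
    ∃ ρ : Plane → ℝ, ContDiff ℝ ∞ ρ ∧ fderiv ℝ ρ p ≠ 0 ∧ Ω ∩ U = {x | x ∈ U ∧ ρ x < 0}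

/-- `G` is a smooth extension to the plane of the restriction of `g` to `S`. -/
def IsSmoothExtension (S : Set Plane) (g G : Plane → ℂ) : Prop :=
  ContDiff ℝ ∞ G ∧ EqOn G g S

/-- The space `L²(Ω; ℂ)`. -/
abbrev L2 (Ω : Set Plane) : Type := Lp ℂ 2 (volume.restrict Ω)

/-- `v` is the weak `i`-th partial derivative of `u` on `Ω`. -/
def HasWeakPartial (Ω : Set Plane) (i : Fin 2) (u v : L2 Ω) : Prop :=
  ∀ φ : Plane → ℝ, IsTestFunction Ω φ →
    ∫ x in Ω, partialDeriv i φ x • u x = - ∫ x in Ω, φ x • v x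

theorem IsTestFunction.partialDeriv_isTestFunction {Ω : Set Plane} {φ : Plane → ℝ} (h : IsTestFunction Ω φ)
    (i : Fin 2) : IsTestFunction Ω (partialDeriv i φ) where
  contDiff := (h.contDiff.fderiv_right (m := ∞) (by simp)).clm_apply contDiff_const
  hasCompactSupport := h.hasCompactSupport.fderiv_apply ℝ _
  tsupport_subset := (tsupport_fderiv_apply_subset ℝ _).trans h.tsupport_subset

theorem IsTestFunction.integrable_smul {Ω : Set Plane} {φ : Plane → ℝ} (h : IsTestFunction Ω φ)
    (u : L2 Ω) : Integrable (fun x => φ x • u x) (volume.restrict Ω) := by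
  have hφ : MemLp φ 2 (volume : Measure Plane) :=
    h.contDiff.continuous.memLp_of_hasCompactSupport h.hasCompactSupport
  have h1 : MemLp (φ • (u : Plane → ℂ)) 1 (volume.restrict Ω) := (Lp.memLp u).smul (hφ.restrict Ω)
  exact memLp_one_iff_integrable.mp h1

/-- The product `L²(Ω; ℂ) × L²(Ω; ℂ)²`, in which a function of `H¹` is recorded together with its
weak gradient; the norm is `(‖u‖² + ‖v₀‖² + ‖v₁‖²)^{1/2}`. -/
abbrev Ambient (Ω : Set Plane) : Type :=
  WithLp 2 (L2 Ω × PiLp 2 (fun _ : Fin 2 => L2 Ω))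

/-- The Sobolev space `H¹(Ω; ℂ)`: the functions in `L²` together with their weak gradient in `L²`
(the gradient is unique when `Ω` is open), with the usual `H¹` norm. -/
noncomputable def H1 (Ω : Set Plane) : Submodule ℂ (Ambient Ω) where
  carrier := {w | ∀ i, HasWeakPartial Ω i w.fst (w.snd i)}
  zero_mem' := by
    intro i φ hφ
    have h0 : ∀ ψ : Plane → ℝ, ∫ x in Ω, ψ x • (0 : L2 Ω) x = 0 := by
      intro ψ
      rw [← integral_zero Plane ℂ (μ := volume.restrict Ω)]
      refine integral_congr_ae ?_
      filter_upwards [Lp.coeFn_zero ℂ 2 (volume.restrict Ω)] with x hx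
      rw [hx, Pi.zero_apply, smul_zero]
    exact (h0 _).trans (by rw [show ((0 : Ambient Ω).snd i) = 0 from rfl, h0, neg_zero])
  add_mem' := by
    intro a b ha hb i φ hφ
    have hadd : ∀ (ψ : Plane → ℝ), IsTestFunction Ω ψ → ∀ v w : L2 Ω,
        ∫ x in Ω, ψ x • (v + w) x = (∫ x in Ω, ψ x • v x) + ∫ x in Ω, ψ x • w x := by
      intro ψ hψ v w
      rw [← integral_add (hψ.integrable_smul v) (hψ.integrable_smul w)]
      refine integral_congr_ae ?_
      filter_upwards [Lp.coeFn_add v w] with x hx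
      rw [hx, Pi.add_apply, smul_add]
    have h1 := hadd _ (hφ.partialDeriv_isTestFunction i) a.fst b.fst
    have h2 := hadd _ hφ (a.snd i) (b.snd i)
    rw [ha i φ hφ, hb i φ hφ] at h1
    refine h1.trans ?_
    rw [show ((a + b).snd i) = a.snd i + b.snd i from rfl, h2, neg_add]
  smul_mem' := by
    intro c a ha i φ hφ
    have hsmul : ∀ (ψ : Plane → ℝ) (v : L2 Ω),
        ∫ x in Ω, ψ x • (c • v) x = c * ∫ x in Ω, ψ x • v x := by
      intro ψ v
      rw [← integral_const_mul]
      refine integral_congr_ae ?_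
      filter_upwards [Lp.coeFn_smul c v] with x hx
      simp [hx]
      ring
    have h1 := hsmul (partialDeriv i φ) a.fst
    rw [ha i φ hφ] at h1
    refine h1.trans ?_
    rw [show ((c • a).snd i) = c • a.snd i from rfl, hsmul, mul_neg]

/-- The `L²` function underlying an element of `H¹(Ω; ℂ)`. -/
noncomputable def H1.toL2 {Ω : Set Plane} (u : H1 Ω) : L2 Ω := u.1.fst

/-- The weak gradient of an element of `H¹(Ω; ℂ)`. -/
noncomputable def H1.grad {Ω : Set Plane} (u : H1 Ω) (i : Fin 2) : L2 Ω := u.1.snd i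

/-- `H¹₀(Ω; ℂ)`: the closure in `H¹(Ω; ℂ)` of the complex-valued test functions on `Ω`. -/
def H10 (Ω : Set Plane) : Set (H1 Ω) :=
  closure {w | ∃ φ : Plane → ℂ, IsTestFunction Ω φ ∧ H1.toL2 w =ᵐ[volume.restrict Ω] φ}

/-- `H¹_g(Ω; ℂ)`: the functions `u ∈ H¹(Ω; ℂ)` with `u = g` on `∂Ω`, that is, `u - G ∈ H¹₀(Ω; ℂ)`
for a smooth extension `G` of the boundary datum `g`. Only the values of `g` on `∂Ω` matter. -/
def H1g (Ω : Set Plane) (g : Plane → ℂ) : Set (H1 Ω) :=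
  {u | ∃ G : Plane → ℂ, IsSmoothExtension (frontier Ω) g G ∧
    ∃ w ∈ H10 Ω, H1.toL2 u =ᵐ[volume.restrict Ω] fun x => G x + H1.toL2 w x}

/-- `H¹_{g₁} × ⋯ × H¹_{gₙ}`. -/
def H1gProd {n : ℕ} (Ω : Set Plane) (g : Fin n → Plane → ℂ) : Set (Fin n → H1 Ω) :=
  {u | ∀ j, u j ∈ H1g Ω (g j)}

/-- `𝒳(g₁, …, gₙ)`: the tuples in `H¹_{g₁} × ⋯ × H¹_{gₙ}` with `∑ |u_j|² = n` a.e. on `Ω`. -/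
def X {n : ℕ} (Ω : Set Plane) (g : Fin n → Plane → ℂ) : Set (Fin n → H1 Ω) :=
  {u | u ∈ H1gProd Ω g ∧ ∀ᵐ x ∂(volume.restrict Ω), ∑ j, ‖H1.toL2 (u j) x‖ ^ 2 = (n : ℝ)}

/-- `I(u₁, …, uₙ) = ∑_j ∫_Ω |∇u_j|²`. -/
noncomputable def I {n : ℕ} {Ω : Set Plane} (u : Fin n → H1 Ω) : ℝ≥0∞ :=
  ∑ j, ∫⁻ x in Ω, ∑ i, ‖H1.grad (u j) i x‖ₑ ^ 2

/-- `∫_Ω (n - ∑_j |u_j|²)²`. -/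
noncomputable def potential {n : ℕ} {Ω : Set Plane} (u : Fin n → H1 Ω) : ℝ≥0∞ :=
  ∫⁻ x in Ω, ENNReal.ofReal (((n : ℝ) - ∑ j, ‖H1.toL2 (u j) x‖ ^ 2) ^ 2)

/-- The energy
`E_ε(u₁, …, uₙ) = 1/2 ∫_Ω ∑_j |∇u_j|² + 1/(4ε²) ∫_Ω (n - ∑_j |u_j|²)²`, for `ε > 0`. -/
noncomputable def E {n : ℕ} {Ω : Set Plane} (ε : ℝ) (u : Fin n → H1 Ω) : ℝ≥0∞ :=
  ENNReal.ofReal (1 / 2) * (∫⁻ x in Ω, ∑ j, ∑ i, ‖H1.grad (u j) i x‖ₑ ^ 2)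
    + ENNReal.ofReal (1 / (4 * ε ^ 2)) * potential u

/-- `u` minimizes `F` over `S`. -/
def IsMinimizer {α : Type*} (F : α → ℝ≥0∞) (S : Set α) (u : α) : Prop :=
  u ∈ S ∧ ∀ v ∈ S, F u ≤ F v

end GinzburgLandau

/-!
The sphere-valued maps in `𝒳` have zero potential energy, so comparing a minimizer `u_ε` of `E_ε`
with any `v ∈ 𝒳` gives (`dirichlet_add_potential_le`)

  `I(u_ε) + (2 ε²)⁻¹ ∫_Ω (n - ∑ |u_{j,ε}|²)² ≤ I(v)`.

All the conclusions are read off from this inequality, once `𝒳` is known to be nonempty and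
`H¹₀(Ω)` to embed compactly in `L²(Ω)`. Indeed `u_ε` is then bounded in `H¹`, so along a subsequence
it converges weakly in `H¹` and strongly in `L²` to some `u⋆` with the right boundary values; the
potential energy is `O(ε²)`, so `u⋆ ∈ 𝒳` by Fatou's lemma. Taking `v = u⋆` gives `I(u_ε) ≤ I(u⋆)`,
which together with weak convergence forces strong convergence of the gradients
(`tendsto_grad_of_dirichlet_le`). Hence `I(u_ε) → I(u⋆)`, so that `u⋆` minimizes `I`, and the
inequality with `v = u⋆` once more shows that the potential energy is `o(ε²)`. The limit for the
whole family follows, since every sequence `ε → 0⁺` has a subsequence with this property.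

* `𝒳` is nonempty (`X_nonempty`) although the degrees of the data are arbitrary, because `n ≥ 2`: a
  smooth extension of `(g₁, …, gₙ)` maps the plane to `ℂⁿ`, which has real dimension `2 n > 2`, so
  it omits a point `a` of the open ball of radius `√n`. Composing it with the radial projection from
  `a` onto the sphere of radius `√n` changes nothing on `∂Ω` and gives an element of `𝒳` that is
  smooth on the whole plane.
* Different elements of `H¹_g(Ω)` may be presented with different smooth extensions of `g`. That
  this makes no difference (`mem_H1g_iff`) amounts to the fact that a smooth function which vanishes
  on `∂Ω` restricts to an element of `H¹₀(Ω)` (`ofSmooth_mem_H10`); it is proved by smooth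
  truncation of the values near `0`, for any bounded open set.
* Compactness (`tendsto_toL2_zero_of_weak`): a test function differs in `L²` from its averages over
  balls of radius `r` by at most `r ‖∇φ‖`, and these averages are integrals against fixed `L²`
  functions, so they converge pointwise and boundedly along a weakly convergent sequence.
-/

namespace GinzburgLandau

universe u

variable {Ω : Set Plane}

/-! ### Square-integrable functions -/

theorem eLpNorm_two_sq {α F : Type*} [MeasurableSpace α] [NormedAddCommGroup F] (μ : Measure α)
    (f : α → F) : eLpNorm f 2 μ ^ 2 = ∫⁻ x, ‖f x‖ₑ ^ 2 ∂μ := by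
  have h := eLpNorm_nnreal_pow_eq_lintegral (f := f) (μ := μ) (p := 2) (by norm_num)
  simpa using h

theorem lintegral_enorm_sq_eq {α F : Type*} [MeasurableSpace α] [NormedAddCommGroup F]
    {μ : Measure α} (f : Lp F 2 μ) : ∫⁻ x, ‖f x‖ₑ ^ 2 ∂μ = ENNReal.ofReal (‖f‖ ^ 2) := by
  rw [← eLpNorm_two_sq, ← Lp.enorm_def, ENNReal.ofReal_pow (norm_nonneg _), ofReal_norm]

/-- Bounded convergence in `L²` of a finite measure. -/
theorem tendsto_toLp_of_bounded {α F : Type*} [MeasurableSpace α] [NormedAddCommGroup F]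
    {μ : Measure α} [IsFiniteMeasure μ] {f : ℕ → α → F} {f₀ : α → F}
    (hf : ∀ k, MemLp (f k) 2 μ) (hf₀ : MemLp f₀ 2 μ) {C : ℝ}
    (hC : ∀ k, ∀ᵐ x ∂μ, ‖f k x - f₀ x‖ ≤ C)
    (hlim : ∀ᵐ x ∂μ, Tendsto (fun k => f k x) atTop (𝓝 (f₀ x))) :
    Tendsto (fun k => (hf k).toLp (f k)) atTop (𝓝 (hf₀.toLp f₀)) := by
  rw [Lp.tendsto_Lp_iff_tendsto_eLpNorm'']
  have h : Tendsto (fun k => ∫⁻ x, ‖(f k - f₀) x‖ₑ ^ 2 ∂μ) atTop (𝓝 (∫⁻ _, 0 ∂μ)) := by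
    refine tendsto_lintegral_of_dominated_convergence' (fun _ => ENNReal.ofReal C ^ 2) ?_ ?_ ?_ ?_
    · exact fun k => (((hf k).1.sub hf₀.1).enorm.pow_const 2)
    · intro k
      filter_upwards [hC k] with x hx
      have : ‖(f k - f₀) x‖ₑ ≤ ENNReal.ofReal C := by
        rw [← ofReal_norm]
        exact ENNReal.ofReal_le_ofReal hx
      gcongr
    · simp [lintegral_const, ENNReal.mul_eq_top]
    · filter_upwards [hlim] with x hx
      have h1 : Tendsto (fun k => f k x - f₀ x) atTop (𝓝 0) := by
        simpa using hx.sub_const (f₀ x)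
      have h2 := ((continuous_enorm.tendsto _).comp h1)
      have h3 := (ENNReal.continuous_pow 2).tendsto _ |>.comp h2
      simpa [Function.comp_def] using h3
  simp only [lintegral_zero, ← eLpNorm_two_sq] at h
  have h4 := ((ENNReal.continuous_rpow_const (y := (1 / 2 : ℝ))).tendsto _).comp h
  have h5 : ∀ a : ℝ≥0∞, (a ^ 2) ^ (1 / 2 : ℝ) = a := fun a => by
    rw [← ENNReal.rpow_natCast, ← ENNReal.rpow_mul]; norm_num
  simpa [Function.comp_def, h5, -one_div] using h4

/-! ### The Sobolev space -/

/-- The element of `H¹(Ω)` with given function and given weak gradient. -/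
noncomputable def H1.mk (u : L2 Ω) (v : Fin 2 → L2 Ω) (h : ∀ i, HasWeakPartial Ω i u (v i)) :
    H1 Ω :=
  ⟨WithLp.toLp 2 (u, WithLp.toLp 2 v), h⟩

/-- `H1.toL2` as a continuous linear map. -/
noncomputable def H1.toL2L (Ω : Set Plane) : H1 Ω →L[ℂ] L2 Ω :=
  (WithLp.fstL 2 ℂ (L2 Ω) (PiLp 2 (fun _ : Fin 2 => L2 Ω))).comp (H1 Ω).subtypeL

/-- `H1.grad` as a continuous linear map. -/
noncomputable def H1.gradL (Ω : Set Plane) (i : Fin 2) : H1 Ω →L[ℂ] L2 Ω :=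
  (PiLp.proj 2 (fun _ : Fin 2 => L2 Ω) i).comp
    ((WithLp.sndL 2 ℂ (L2 Ω) (PiLp 2 (fun _ : Fin 2 => L2 Ω))).comp (H1 Ω).subtypeL)

theorem H1.toL2L_apply (u : H1 Ω) : H1.toL2L Ω u = H1.toL2 u := rfl

theorem H1.gradL_apply (u : H1 Ω) (i) : H1.gradL Ω i u = H1.grad u i := rfl

theorem H1.toL2_sub (u v : H1 Ω) : H1.toL2 (u - v) = H1.toL2 u - H1.toL2 v := rfl

theorem H1.toL2_add (u v : H1 Ω) : H1.toL2 (u + v) = H1.toL2 u + H1.toL2 v := rfl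

theorem H1.grad_sub (u v : H1 Ω) (i) : H1.grad (u - v) i = H1.grad u i - H1.grad v i := rfl

theorem H1.norm_sq (u : H1 Ω) : ‖u‖ ^ 2 = ‖H1.toL2 u‖ ^ 2 + ∑ i, ‖H1.grad u i‖ ^ 2 := by
  have h1 : ‖u‖ = ‖(u : Ambient Ω)‖ := rfl
  rw [h1, WithLp.prod_norm_sq_eq_of_L2, PiLp.norm_sq_eq_of_L2]
  rfl

theorem H1.norm_toL2_le (u : H1 Ω) : ‖H1.toL2 u‖ ≤ ‖u‖ := by
  have := H1.norm_sq u
  have h2 : 0 ≤ ∑ i, ‖H1.grad u i‖ ^ 2 := by positivity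
  exact abs_le_of_sq_le_sq' (by linarith) (norm_nonneg _) |>.2

theorem H1.tendsto_iff {ι : Type*} {l : Filter ι} {u : ι → H1 Ω} {v : H1 Ω} :
    Tendsto u l (𝓝 v) ↔ Tendsto (fun k => H1.toL2 (u k)) l (𝓝 (H1.toL2 v)) ∧
      ∀ i, Tendsto (fun k => H1.grad (u k) i) l (𝓝 (H1.grad v i)) := by
  constructor
  · intro h
    exact ⟨((H1.toL2L Ω).continuous.tendsto v).comp h,
      fun i => ((H1.gradL Ω i).continuous.tendsto v).comp h⟩
  · rintro ⟨h1, h2⟩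
    rw [tendsto_iff_norm_sub_tendsto_zero] at h1 ⊢
    have h3 : ∀ i, Tendsto (fun k => ‖H1.grad (u k) i - H1.grad v i‖) l (𝓝 0) := fun i =>
      tendsto_iff_norm_sub_tendsto_zero.1 (h2 i)
    have h4 : Tendsto (fun k => ‖H1.toL2 (u k) - H1.toL2 v‖ ^ 2 +
        ∑ i, ‖H1.grad (u k) i - H1.grad v i‖ ^ 2)
        l (𝓝 (0 ^ 2 + ∑ i : Fin 2, 0 ^ 2)) :=
      (h1.pow 2).add (tendsto_finsetSum _ fun i _ => (h3 i).pow 2)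
    have h5 := (Real.continuous_sqrt.tendsto _).comp h4
    have h6 : ∀ k, √(‖H1.toL2 (u k) - H1.toL2 v‖ ^ 2 + ∑ i, ‖H1.grad (u k) i - H1.grad v i‖ ^ 2)
        = ‖u k - v‖ := fun k => by
      rw [← H1.toL2_sub]
      simp_rw [← H1.grad_sub]
      rw [← H1.norm_sq, Real.sqrt_sq (norm_nonneg _)]
    rw [show (0 : ℝ) = √(0 ^ 2 + ∑ i : Fin 2, 0 ^ 2) by simp]
    exact h5.congr h6

theorem IsTestFunction.continuous_integral_smul {φ : Plane → ℝ} (h : IsTestFunction Ω φ) :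
    Continuous fun u : L2 Ω => ∫ x in Ω, φ x • u x := by
  have hφ : MemLp (fun x => (φ x : ℂ)) 2 (volume.restrict Ω) :=
    ((Complex.continuous_ofReal.comp h.contDiff.continuous).memLp_of_hasCompactSupport
      (h.hasCompactSupport.comp_left Complex.ofReal_zero)).restrict Ω
  have h1 : (fun u : L2 Ω => ∫ x in Ω, φ x • u x) = fun u : L2 Ω => inner ℂ (hφ.toLp _) u := by
    ext u
    rw [L2.inner_def]
    refine integral_congr_ae ?_
    filter_upwards [hφ.coeFn_toLp] with x hx
    rw [hx]
    simp [mul_comm]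
  rw [h1]
  fun_prop

theorem isClosed_H1 (Ω : Set Plane) : IsClosed (H1 Ω : Set (Ambient Ω)) := by
  have : (H1 Ω : Set (Ambient Ω)) = ⋂ (i : Fin 2) (φ : Plane → ℝ) (_ : IsTestFunction Ω φ),
      {w : Ambient Ω | ∫ x in Ω, partialDeriv i φ x • w.fst x = - ∫ x in Ω, φ x • w.snd i x} := by
    ext w
    simp only [mem_iInter, mem_ofPred_eq]
    rfl
  rw [this]
  refine isClosed_iInter fun i => isClosed_iInter fun φ => isClosed_iInter fun h => ?_
  refine isClosed_eq ?_ ?_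
  · exact (h.partialDeriv_isTestFunction i).continuous_integral_smul.comp
      (WithLp.fstL 2 ℂ (L2 Ω) (PiLp 2 (fun _ : Fin 2 => L2 Ω))).continuous
  · exact (h.continuous_integral_smul.comp ((PiLp.proj (𝕜 := ℂ) 2 (fun _ : Fin 2 => L2 Ω) i).comp
      (WithLp.sndL 2 ℂ (L2 Ω) (PiLp 2 (fun _ : Fin 2 => L2 Ω)))).continuous).neg

instance : CompleteSpace (H1 Ω) := (isClosed_H1 Ω).completeSpace_coe

theorem HasWeakPartial.of_tendsto {i : Fin 2} {u v : ℕ → L2 Ω} {u₀ v₀ : L2 Ω}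
    (h : ∀ k, HasWeakPartial Ω i (u k) (v k)) (hu : Tendsto u atTop (𝓝 u₀))
    (hv : Tendsto v atTop (𝓝 v₀)) : HasWeakPartial Ω i u₀ v₀ := by
  intro φ hφ
  refine tendsto_nhds_unique
    (((hφ.partialDeriv_isTestFunction i).continuous_integral_smul.tendsto _).comp hu) ?_
  have := ((hφ.continuous_integral_smul.tendsto _).comp hv).neg
  exact this.congr fun k => (h k φ hφ).symm

theorem HasWeakPartial.unique (hΩ : IsOpen Ω) {i : Fin 2} {u v w : L2 Ω}
    (hv : HasWeakPartial Ω i u v) (hw : HasWeakPartial Ω i u w) : v = w := by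
  rw [← sub_eq_zero, Lp.ext_iff]
  have hint : LocallyIntegrableOn (v - w : L2 Ω) Ω volume := by
    rw [locallyIntegrableOn_iff hΩ.isLocallyClosed]
    intro K hK hKc
    have h1 : MemLp (v - w : L2 Ω) 2 (volume.restrict K) :=
      (Lp.memLp (v - w)).mono_measure (Measure.restrict_mono hK le_rfl)
    have : IsFiniteMeasure (volume.restrict K) := ⟨by simpa using hKc.measure_lt_top⟩
    exact h1.integrable (by norm_num)
  have h2 := hΩ.ae_eq_zero_of_integral_contDiff_smul_eq_zero hint fun φ h1 h2 h3 => by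
    have hφ : IsTestFunction Ω φ := ⟨h1, h2, h3⟩
    rw [← setIntegral_eq_integral_of_forall_compl_eq_zero (s := Ω)]
    · have h4 : ∫ x in Ω, φ x • (v - w : L2 Ω) x = ∫ x in Ω, φ x • v x - φ x • w x := by
        refine integral_congr_ae ?_
        filter_upwards [Lp.coeFn_sub v w] with x hx
        rw [hx, Pi.sub_apply, smul_sub]
      rw [h4, integral_sub (hφ.integrable_smul v) (hφ.integrable_smul w), sub_eq_zero]
      exact neg_injective ((hv φ hφ).symm.trans (hw φ hφ))
    · intro x hx
      rw [image_eq_zero_of_notMem_tsupport fun h => hx (h3 h), zero_smul]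
  have h3 := (ae_restrict_iff' hΩ.measurableSet).2 h2
  filter_upwards [h3, Lp.coeFn_zero ℂ 2 (volume.restrict Ω)] with x hx hx0
  rw [hx, hx0, Pi.zero_apply]

theorem H1.ext_toL2 (hΩ : IsOpen Ω) {u v : H1 Ω} (h : H1.toL2 u = H1.toL2 v) : u = v := by
  have h1 : ∀ i, H1.grad u i = H1.grad v i := fun i => by
    have hu : HasWeakPartial Ω i (H1.toL2 u) (H1.grad u i) := u.2 i
    have hv : HasWeakPartial Ω i (H1.toL2 v) (H1.grad v i) := v.2 i
    rw [h] at hu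
    exact hu.unique hΩ hv
  have h2 : ‖u - v‖ ^ 2 = 0 := by
    rw [H1.norm_sq, H1.toL2_sub, h]
    simp [H1.grad_sub, h1]
  exact sub_eq_zero.1 (norm_eq_zero.1 (by simpa using h2))

/-! ### Smooth functions as elements of the Sobolev space -/

theorem _root_.Continuous.memLp_restrict_of_isBounded (hb : Bornology.IsBounded Ω) {f : Plane → ℂ}
    (hf : Continuous f) : MemLp f 2 (volume.restrict Ω) := by
  have hK : IsCompact (closure Ω) := hb.isCompact_closure
  have h1 : MemLp f 2 (volume.restrict (closure Ω)) := by
    obtain ⟨C, hC⟩ := hK.exists_bound_of_continuousOn hf.continuousOn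
    have : IsFiniteMeasure (volume.restrict (closure Ω)) := ⟨by simpa using hK.measure_lt_top⟩
    refine MemLp.of_bound hf.aestronglyMeasurable C ?_
    exact (ae_restrict_iff' isClosed_closure.measurableSet).2 (ae_of_all _ hC)
  exact h1.mono_measure (Measure.restrict_mono subset_closure le_rfl)

theorem continuous_partialDeriv {f : Plane → ℂ} (hf : ContDiff ℝ ∞ f) (i : Fin 2) :
    Continuous (partialDeriv i f) :=
  (hf.continuous_fderiv (by simp)).clm_apply continuous_const

theorem hasWeakPartial_of_contDiff (hb : Bornology.IsBounded Ω) {f : Plane → ℂ}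
    (hf : ContDiff ℝ ∞ f) (i : Fin 2) :
    HasWeakPartial Ω i ((hf.continuous.memLp_restrict_of_isBounded hb).toLp f)
      (((continuous_partialDeriv hf i).memLp_restrict_of_isBounded hb).toLp _) := by
  intro φ hφ
  have hcongr : ∀ (ψ : Plane → ℝ) (_ : IsTestFunction Ω ψ) (F : Plane → ℂ)
      (hF : MemLp F 2 (volume.restrict Ω)),
      ∫ x in Ω, ψ x • (hF.toLp F) x = ∫ x, ψ x • F x := by
    intro ψ hψ F hF
    rw [← setIntegral_eq_integral_of_forall_compl_eq_zero (s := Ω)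
      (f := fun x => ψ x • F x)]
    · refine integral_congr_ae ?_
      filter_upwards [hF.coeFn_toLp] with x hx
      rw [hx]
    · intro x hx
      rw [image_eq_zero_of_notMem_tsupport fun h => hx (hψ.tsupport_subset h), zero_smul]
  have hint : ∀ (ψ : Plane → ℝ) (_ : IsTestFunction Ω ψ) (F : Plane → ℂ) (_ : Continuous F),
      Integrable (fun x => ψ x • F x) := fun ψ hψ F hF =>
    (hψ.contDiff.continuous.smul hF).integrable_of_hasCompactSupport
      hψ.hasCompactSupport.smul_right
  rw [hcongr _ (hφ.partialDeriv_isTestFunction i), hcongr _ hφ, eq_neg_iff_add_eq_zero, add_comm,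
    ← eq_neg_iff_add_eq_zero]
  exact integral_smul_fderiv_eq_neg_fderiv_smul_of_integrable (𝕜 := ℝ) (f := φ) (g := f)
    (v := EuclideanSpace.single i 1)
    (hint _ (hφ.partialDeriv_isTestFunction i) _ hf.continuous)
    (hint _ hφ _ (continuous_partialDeriv hf i)) (hint _ hφ _ hf.continuous)
    (fun x _ => hφ.contDiff.differentiable (by simp) x)
    (fun x _ => hf.differentiable (by simp) x)

/-- The restriction to a bounded set `Ω` of a smooth function on the plane, as an element of
`H¹(Ω)`. -/
noncomputable def H1.ofSmooth (hb : Bornology.IsBounded Ω) (f : Plane → ℂ) (hf : ContDiff ℝ ∞ f) :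
    H1 Ω :=
  H1.mk _ _ (hasWeakPartial_of_contDiff hb hf)

theorem H1.toL2_ofSmooth (hb : Bornology.IsBounded Ω) {f : Plane → ℂ} (hf : ContDiff ℝ ∞ f) :
    H1.toL2 (H1.ofSmooth hb f hf) =ᵐ[volume.restrict Ω] f :=
  MemLp.coeFn_toLp (hf.continuous.memLp_restrict_of_isBounded hb)

theorem H1.grad_ofSmooth (hb : Bornology.IsBounded Ω) {f : Plane → ℂ} (hf : ContDiff ℝ ∞ f)
    (i : Fin 2) : H1.grad (H1.ofSmooth hb f hf) i =ᵐ[volume.restrict Ω] partialDeriv i f :=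
  MemLp.coeFn_toLp ((continuous_partialDeriv hf i).memLp_restrict_of_isBounded hb)

theorem H1.eq_ofSmooth (hΩ : IsOpen Ω) (hb : Bornology.IsBounded Ω) {f : Plane → ℂ}
    (hf : ContDiff ℝ ∞ f) {u : H1 Ω} (hu : H1.toL2 u =ᵐ[volume.restrict Ω] f) :
    u = H1.ofSmooth hb f hf :=
  H1.ext_toL2 hΩ (Lp.ext (hu.trans (H1.toL2_ofSmooth hb hf).symm))

/-- The complex linear subspace of `H¹(Ω)` formed by the test functions. -/
noncomputable def testSubmodule (Ω : Set Plane) : Submodule ℂ (H1 Ω) where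
  carrier := {w | ∃ φ : Plane → ℂ, IsTestFunction Ω φ ∧ H1.toL2 w =ᵐ[volume.restrict Ω] φ}
  zero_mem' := ⟨0, ⟨contDiff_const, HasCompactSupport.zero, by simp [tsupport]⟩,
    Lp.coeFn_zero ℂ 2 _⟩
  add_mem' := by
    rintro a b ⟨φ, hφ, ha⟩ ⟨ψ, hψ, hb⟩
    refine ⟨φ + ψ, ⟨hφ.contDiff.add hψ.contDiff, hφ.hasCompactSupport.add hψ.hasCompactSupport,
      (tsupport_add φ ψ).trans (union_subset hφ.tsupport_subset hψ.tsupport_subset)⟩, ?_⟩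
    rw [H1.toL2_add]
    exact (Lp.coeFn_add _ _).trans (ha.add hb)
  smul_mem' := by
    rintro c a ⟨φ, hφ, ha⟩
    have hsupp : tsupport (c • φ) ⊆ tsupport φ :=
      closure_mono (Function.support_const_smul_subset c φ)
    refine ⟨c • φ, ⟨hφ.contDiff.const_smul c,
      hφ.hasCompactSupport.of_isClosed_subset (isClosed_tsupport _) hsupp,
      hsupp.trans hφ.tsupport_subset⟩, ?_⟩
    exact (Lp.coeFn_smul c (H1.toL2 a)).trans (ha.const_smul c)

/-- `H¹₀(Ω)` as a closed subspace. -/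
noncomputable def H10sub (Ω : Set Plane) : Submodule ℂ (H1 Ω) :=
  (testSubmodule Ω).topologicalClosure

theorem mem_H10sub {w : H1 Ω} : w ∈ H10sub Ω ↔ w ∈ H10 Ω := Iff.rfl

theorem isClosed_H10sub (Ω : Set Plane) : IsClosed (H10sub Ω : Set (H1 Ω)) :=
  Submodule.isClosed_topologicalClosure (testSubmodule Ω)

/-! ### Smooth functions vanishing on the boundary -/

/-- A smooth truncation: it vanishes near `0` and is the identity far from `0`. -/
theorem exists_smooth_truncation : ∃ θ : ℂ → ℂ, ContDiff ℝ ∞ θ ∧ (∀ z, ‖z‖ ≤ 1 → θ z = 0) ∧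
    (∀ z, 2 ≤ ‖z‖ → θ z = z) ∧ (∀ z, ‖θ z - z‖ ≤ 2) ∧ ∃ C, ∀ z, ‖fderiv ℝ θ z‖ ≤ C := by
  let b : ContDiffBump (0 : ℂ) := ⟨1, 2, one_pos, one_lt_two⟩
  have hb0 : ∀ z : ℂ, 2 ≤ ‖z‖ → b z = 0 := fun z hz => b.zero_of_le_dist (by simpa using hz)
  have hbs : ContDiff ℝ ∞ fun z : ℂ => b z • z := (b.contDiff (n := ⊤)).smul contDiff_id
  have hsupp : HasCompactSupport fun z : ℂ => b z • z := b.hasCompactSupport.smul_right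
  refine ⟨fun z => z - b z • z, contDiff_id.sub hbs, ?_, ?_, ?_, ?_⟩
  · intro z hz
    simp only [b.one_of_mem_closedBall (by simpa using hz), one_smul, sub_self]
  · intro z hz
    simp only [hb0 z hz, zero_smul, sub_zero]
  · intro z
    rcases le_total 2 ‖z‖ with hz | hz
    · simp [hb0 z hz]
    · rw [sub_sub_cancel_left, norm_neg, norm_smul, Real.norm_of_nonneg b.nonneg]
      nlinarith [b.le_one (x := z), b.nonneg (x := z), norm_nonneg z]
  · obtain ⟨C, hC⟩ := (hbs.continuous_fderiv (by simp)).bounded_above_of_compact_support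
      (hsupp.fderiv ℝ)
    refine ⟨1 + C, fun z => ?_⟩
    rw [fderiv_fun_sub differentiableAt_fun_id (hbs.differentiable (by simp) z)]
    refine (norm_sub_le _ _).trans (add_le_add ?_ (hC z))
    rw [fderiv_fun_id]
    exact ContinuousLinearMap.norm_id_le

/-- If `f` is smooth and vanishes on `∂Ω`, cutting off the values of `f` near `0` gives a test
function on `Ω`. -/
theorem isTestFunction_indicator_truncation (hΩ : IsOpen Ω) (hb : Bornology.IsBounded Ω)
    {f : Plane → ℂ} (hf : ContDiff ℝ ∞ f) (h0 : ∀ x ∈ frontier Ω, f x = 0) {θ : ℂ → ℂ}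
    (hθ : ContDiff ℝ ∞ θ) {δ : ℝ} (hδ : 0 < δ) (hθ0 : ∀ z, ‖z‖ ≤ δ → θ z = 0) :
    IsTestFunction Ω (Ω.indicator fun x => θ (f x)) := by
  set K : Set Plane := closure Ω ∩ {x | δ ≤ ‖f x‖}
  have hKclosed : IsClosed K :=
    isClosed_closure.inter (isClosed_le continuous_const hf.continuous.norm)
  have hKc : IsCompact K := hb.isCompact_closure.inter_right
    (isClosed_le continuous_const hf.continuous.norm)
  have hKΩ : K ⊆ Ω := by
    rintro x ⟨hx, hx'⟩
    by_contra hn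
    have : x ∈ frontier Ω := ⟨hx, by rwa [hΩ.interior_eq]⟩
    have h1 : δ ≤ ‖f x‖ := hx'
    rw [h0 x this, norm_zero] at h1
    exact absurd h1 (not_le.2 hδ)
  have hzero : ∀ x, x ∉ K → Ω.indicator (fun x => θ (f x)) x = 0 := by
    intro x hx
    by_cases hxΩ : x ∈ Ω
    · rw [indicator_of_mem hxΩ]
      refine hθ0 _ (le_of_lt (not_le.1 fun h => hx ⟨subset_closure hxΩ, h⟩))
    · exact indicator_of_notMem hxΩ _
  have hsub : tsupport (Ω.indicator fun x => θ (f x)) ⊆ K :=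
    closure_minimal (fun x hx => by_contra fun h => hx (hzero x h)) hKclosed
  refine ⟨?_, hKc.of_isClosed_subset (isClosed_tsupport _) hsub, hsub.trans hKΩ⟩
  rw [contDiff_iff_contDiffAt]
  intro x
  by_cases hx : x ∈ Ω
  · refine (hθ.comp hf).contDiffAt.congr_of_eventuallyEq ?_
    filter_upwards [hΩ.mem_nhds hx] with y hy
    rw [indicator_of_mem hy]
    rfl
  · refine (contDiffAt_const (c := (0 : ℂ))).congr_of_eventuallyEq ?_
    filter_upwards [hKclosed.isOpen_compl.mem_nhds fun h => hx (hKΩ h)] with y hy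
    exact hzero y hy

/-- A smooth function on the plane which vanishes on `∂Ω` restricts to an element of `H¹₀(Ω)`;
no regularity of the boundary is needed. The truncations `δ θ(f / δ)` converge to `f` in `L²`,
and their gradients converge to `∇f` cut off to `{f ≠ 0}`; as weak gradients are closed and unique,
that limit is `∇f`. -/
theorem ofSmooth_mem_H10 (hΩ : IsOpen Ω) (hb : Bornology.IsBounded Ω) {f : Plane → ℂ}
    (hf : ContDiff ℝ ∞ f) (h0 : ∀ x ∈ frontier Ω, f x = 0) : H1.ofSmooth hb f hf ∈ H10 Ω := by
  obtain ⟨θ, hθs, hθ0, hθid, hθb, C, hC⟩ := exists_smooth_truncation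
  have : IsFiniteMeasure (volume.restrict Ω) := ⟨by simpa using hb.measure_lt_top⟩
  have hθ00 : ∀ z : ℂ, ‖z‖ < 1 → fderiv ℝ θ z = 0 := fun z hz => by
    have h1 : θ =ᶠ[𝓝 z] fun _ => 0 := by
      filter_upwards [(isOpen_lt continuous_norm continuous_const).mem_nhds hz] with y hy
      exact hθ0 y (le_of_lt hy)
    rw [h1.fderiv_eq, fderiv_fun_const]; rfl
  have hθ1 : ∀ z : ℂ, 2 < ‖z‖ → fderiv ℝ θ z = ContinuousLinearMap.id ℝ ℂ := fun z hz => by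
    have h1 : θ =ᶠ[𝓝 z] fun y => y := by
      filter_upwards [(isOpen_lt continuous_const continuous_norm).mem_nhds hz] with y hy
      exact hθid y (le_of_lt hy)
    rw [h1.fderiv_eq, fderiv_fun_id]
  -- the truncation at the scale `δ = 1 / c k`
  set c : ℕ → ℝ := fun k => (k : ℝ) + 1 with hc
  have hc0 : ∀ k, 0 < c k := fun k => by positivity
  have hclim : Tendsto c atTop atTop := tendsto_natCast_atTop_atTop.atTop_add tendsto_const_nhds
  set T : ℕ → ℂ → ℂ := fun k z => (c k)⁻¹ • θ (c k • z) with hT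
  have hTs : ∀ k, ContDiff ℝ ∞ (T k) := fun k =>
    (hθs.comp (contDiff_id.const_smul (c k))).const_smul _
  have hTD : ∀ k z, fderiv ℝ (T k) z = fderiv ℝ θ (c k • z) := fun k z => by
    have h1 : HasFDerivAt θ (fderiv ℝ θ (c k • z)) (c k • z) :=
      (hθs.differentiable (by simp) _).hasFDerivAt
    have h2 : HasFDerivAt (fun z : ℂ => c k • z) (c k • ContinuousLinearMap.id ℝ ℂ) z :=
      (hasFDerivAt_id z).const_smul (c k)
    have h3 := (h1.comp z h2).const_smul (c k)⁻¹
    refine (h3.fderiv).trans ?_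
    ext1
    simp [(hc0 k).ne']
  have hnorm : ∀ k (z : ℂ), ‖c k • z‖ = c k * ‖z‖ := fun k z => by
    rw [norm_smul, Real.norm_of_nonneg (hc0 k).le]
  have hlarge : ∀ z : ℂ, z ≠ 0 → ∀ᶠ k in atTop, 2 < ‖c k • z‖ := fun z hz => by
    filter_upwards [(hclim.atTop_mul_const (norm_pos_iff.2 hz)).eventually_gt_atTop 2] with k hk
    rwa [hnorm]
  have hTf : ∀ k, ContDiff ℝ ∞ fun x => T k (f x) := fun k => (hTs k).comp hf
  have hTfD : ∀ k i x, partialDeriv i (fun x => T k (f x)) x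
      = fderiv ℝ θ (c k • f x) (partialDeriv i f x) := fun k i x => by
    have := ((hTs k).differentiable (by simp) (f x)).hasFDerivAt.comp x
      (hf.differentiable (by simp) x).hasFDerivAt
    rw [partialDeriv, ← hTD]
    exact congrArg (fun L : Plane →L[ℝ] ℂ => L (EuclideanSpace.single i 1)) this.fderiv
  set w : ℕ → H1 Ω := fun k => H1.ofSmooth hb _ (hTf k)
  have hwtest : ∀ k, w k ∈ {w | ∃ φ : Plane → ℂ, IsTestFunction Ω φ ∧
      H1.toL2 w =ᵐ[volume.restrict Ω] φ} := fun k => by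
    refine ⟨_, isTestFunction_indicator_truncation hΩ hb hf h0 (hTs k) (inv_pos.2 (hc0 k)) ?_, ?_⟩
    · intro z hz
      have : ‖c k • z‖ ≤ 1 := by
        rw [hnorm]
        calc c k * ‖z‖ ≤ c k * (c k)⁻¹ := by gcongr
          _ = 1 := mul_inv_cancel₀ (hc0 k).ne'
      simp only [hT, hθ0 _ this, smul_zero]
    · filter_upwards [H1.toL2_ofSmooth hb (hTf k), ae_restrict_mem hΩ.measurableSet] with x hx hxΩ
      rw [indicator_of_mem hxΩ]
      exact hx
  have hlim0 : Tendsto (fun k => H1.toL2 (w k)) atTop (𝓝 (H1.toL2 (H1.ofSmooth hb f hf))) := by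
    refine tendsto_toLp_of_bounded (C := 2)
      (fun k => (hTf k).continuous.memLp_restrict_of_isBounded hb)
      (hf.continuous.memLp_restrict_of_isBounded hb) (fun k => ae_of_all _ fun x => ?_)
      (ae_of_all _ fun x => ?_)
    · have h1 : T k (f x) - f x = (c k)⁻¹ • (θ (c k • f x) - c k • f x) := by
        rw [smul_sub, inv_smul_smul₀ (hc0 k).ne']
      rw [h1, norm_smul, norm_inv, Real.norm_of_nonneg (hc0 k).le]
      have h2 : (c k)⁻¹ ≤ 1 := inv_le_one_of_one_le₀ (by simp [hc])
      nlinarith [hθb (c k • f x), norm_nonneg (θ (c k • f x) - c k • f x), inv_pos.2 (hc0 k)]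
    · rcases eq_or_ne (f x) 0 with hx | hx
      · simp [hx, hT, hθ0]
      · refine tendsto_const_nhds.congr' ?_
        filter_upwards [hlarge _ hx] with k hk
        rw [hT]
        simp only
        rw [hθid _ hk.le, inv_smul_smul₀ (hc0 k).ne']
  -- the pointwise limit of the gradients
  have hmeas : MeasurableSet {x | f x ≠ 0} :=
    (isOpen_ne_fun hf.continuous continuous_const).measurableSet
  have hDf : ∀ i, MemLp (partialDeriv i f) 2 (volume.restrict Ω) := fun i =>
    (continuous_partialDeriv hf i).memLp_restrict_of_isBounded hb
  have hlim1 : ∀ i, Tendsto (fun k => H1.grad (w k) i) atTop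
      (𝓝 (((hDf i).indicator hmeas).toLp ({x | f x ≠ 0}.indicator (partialDeriv i f)))) := by
    intro i
    obtain ⟨B, hB⟩ := hb.isCompact_closure.exists_bound_of_continuousOn
      (continuous_partialDeriv hf i).continuousOn
    refine tendsto_toLp_of_bounded (C := C * B + B)
      (fun k => (continuous_partialDeriv (hTf k) i).memLp_restrict_of_isBounded hb)
      ((hDf i).indicator hmeas) (fun k => ?_) (ae_of_all _ fun x => ?_)
    · filter_upwards [ae_restrict_mem hΩ.measurableSet] with x hx
      have hBx := hB x (subset_closure hx)
      refine (norm_sub_le _ _).trans (add_le_add ?_ ?_)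
      · rw [hTfD]
        exact (ContinuousLinearMap.le_opNorm _ _).trans
          (mul_le_mul (hC _) hBx (norm_nonneg _) ((norm_nonneg _).trans (hC 0)))
      · exact (norm_indicator_le_norm_self _ _).trans hBx
    · simp only [hTfD]
      rcases eq_or_ne (f x) 0 with hx | hx
      · rw [indicator_of_notMem (by simp [hx])]
        simp [hx, hθ00 0 (by simp)]
      · rw [indicator_of_mem (by simpa using hx)]
        refine tendsto_const_nhds.congr' ?_
        filter_upwards [hlarge _ hx] with k hk
        rw [hθ1 _ hk]
        rfl
  have hgrad : ∀ i, H1.grad (H1.ofSmooth hb f hf) i =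
      ((hDf i).indicator hmeas).toLp ({x | f x ≠ 0}.indicator (partialDeriv i f)) := fun i =>
    HasWeakPartial.unique hΩ ((H1.ofSmooth hb f hf).2 i)
      (HasWeakPartial.of_tendsto (fun k => (w k).2 i) hlim0 (hlim1 i))
  exact mem_closure_of_tendsto
    (H1.tendsto_iff.2 ⟨hlim0, fun i => by rw [hgrad i]; exact hlim1 i⟩)
    (Eventually.of_forall hwtest)

/-- Membership in `H¹_g(Ω)` does not depend on the smooth extension of `g`. -/
theorem mem_H1g_iff (hΩ : IsOpen Ω) (hb : Bornology.IsBounded Ω) {g G : Plane → ℂ}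
    (hG : IsSmoothExtension (frontier Ω) g G) {u : H1 Ω} :
    u ∈ H1g Ω g ↔ u - H1.ofSmooth hb G hG.1 ∈ H10sub Ω := by
  constructor
  · rintro ⟨G', hG', w, hw, hu⟩
    have h1 : H1.ofSmooth hb (fun x => G' x - G x) (hG'.1.sub hG.1) ∈ H10sub Ω :=
      ofSmooth_mem_H10 hΩ hb _ fun x hx => by rw [hG'.2 hx, hG.2 hx, sub_self]
    have h2 : u - H1.ofSmooth hb G hG.1 =
        w + H1.ofSmooth hb (fun x => G' x - G x) (hG'.1.sub hG.1) := by
      refine H1.ext_toL2 hΩ (Lp.ext ?_)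
      rw [H1.toL2_sub, H1.toL2_add]
      filter_upwards [Lp.coeFn_sub (H1.toL2 u) (H1.toL2 (H1.ofSmooth hb G hG.1)),
        Lp.coeFn_add (H1.toL2 w)
          (H1.toL2 (H1.ofSmooth hb (fun x => G' x - G x) (hG'.1.sub hG.1))),
        H1.toL2_ofSmooth hb hG.1, H1.toL2_ofSmooth hb (hG'.1.sub hG.1), hu] with x e1 e2 e3 e4 e5
      rw [e1, e2, Pi.sub_apply, Pi.add_apply, e3, e4, e5]
      ring
    rw [h2]
    exact add_mem (mem_H10sub.2 hw) h1
  · intro h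
    refine ⟨G, hG, _, h, ?_⟩
    rw [H1.toL2_sub]
    filter_upwards [Lp.coeFn_sub (H1.toL2 u) (H1.toL2 (H1.ofSmooth hb G hG.1)),
      H1.toL2_ofSmooth hb hG.1] with x e1 e2
    rw [e1, Pi.sub_apply, e2]
    ring

/-! ### Compactness of `H¹₀` in `L²` -/

/-- Jensen's inequality for the square of the norm. -/
theorem enorm_integral_sq_le {α : Type*} [MeasurableSpace α] (μ : Measure α)
    [IsProbabilityMeasure μ] {f : α → ℂ} (hf : AEStronglyMeasurable f μ) :
    ‖∫ x, f x ∂μ‖ₑ ^ 2 ≤ ∫⁻ x, ‖f x‖ₑ ^ 2 ∂μ := by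
  rw [← eLpNorm_two_sq]
  have h1 : ‖∫ x, f x ∂μ‖ₑ ≤ eLpNorm f 1 μ := by
    rw [eLpNorm_one_eq_lintegral_enorm]
    exact enorm_integral_le_lintegral_enorm f
  have h2 := h1.trans (eLpNorm_le_eLpNorm_of_exponent_le (p := 1) (q := 2) (by norm_num) hf)
  gcongr

/-- Translating a smooth function by `h` changes it in `L²` by at most `‖h‖ ‖∇φ‖`. -/
theorem lintegral_translate_sub_sq_le {φ : Plane → ℂ} (hφ : ContDiff ℝ ∞ φ) (h : Plane) :
    ∫⁻ x, ‖φ (x + h) - φ x‖ₑ ^ 2 ≤ ‖h‖ₑ ^ 2 * ∫⁻ x, ‖fderiv ℝ φ x‖ₑ ^ 2 := by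
  have hD : Continuous (fderiv ℝ φ) := hφ.continuous_fderiv (by simp)
  set μ : Measure ℝ := volume.restrict (Ioc 0 1)
  have : IsProbabilityMeasure μ := ⟨by simp [μ]⟩
  have hpt : ∀ x, ‖φ (x + h) - φ x‖ₑ ^ 2 ≤ ∫⁻ t, ‖h‖ₑ ^ 2 * ‖fderiv ℝ φ (x + t • h)‖ₑ ^ 2 ∂μ := by
    intro x
    have hcont : Continuous fun t : ℝ => fderiv ℝ φ (x + t • h) h := by fun_prop
    have h1 : ∫ t, fderiv ℝ φ (x + t • h) h ∂μ = φ (x + h) - φ x := by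
      have h2 : ∀ t ∈ uIcc (0 : ℝ) 1, HasDerivAt (fun t : ℝ => φ (x + t • h))
          (fderiv ℝ φ (x + t • h) h) t := fun t _ => by
        have h3 : HasDerivAt (fun t : ℝ => x + t • h) ((1 : ℝ) • h) t :=
          ((hasDerivAt_id t).smul_const h).const_add x
        rw [one_smul] at h3
        exact (hφ.differentiable (by simp) _).hasFDerivAt.comp_hasDerivAt t h3
      have h4 := intervalIntegral.integral_eq_sub_of_hasDerivAt h2 (hcont.intervalIntegrable _ _)
      rw [intervalIntegral.integral_of_le zero_le_one] at h4
      simpa using h4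
    rw [← h1]
    refine (enorm_integral_sq_le μ hcont.aestronglyMeasurable).trans (lintegral_mono fun t => ?_)
    rw [← mul_pow, mul_comm]
    gcongr
    exact ContinuousLinearMap.le_opENorm _ _
  calc ∫⁻ x, ‖φ (x + h) - φ x‖ₑ ^ 2
      ≤ ∫⁻ x, ∫⁻ t, ‖h‖ₑ ^ 2 * ‖fderiv ℝ φ (x + t • h)‖ₑ ^ 2 ∂μ := lintegral_mono hpt
    _ = ∫⁻ t, ∫⁻ x, ‖h‖ₑ ^ 2 * ‖fderiv ℝ φ (x + t • h)‖ₑ ^ 2 ∂volume ∂μ := by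
        refine lintegral_lintegral_swap ?_
        have : Continuous fun p : Plane × ℝ => fderiv ℝ φ (p.1 + p.2 • h) := by fun_prop
        exact ((this.enorm.measurable.pow_const 2).const_mul _).aemeasurable
    _ = ∫⁻ _t, (‖h‖ₑ ^ 2 * ∫⁻ x, ‖fderiv ℝ φ x‖ₑ ^ 2) ∂μ := by
        refine lintegral_congr fun t => ?_
        have : Continuous fun x : Plane => fderiv ℝ φ (x + t • h) := by fun_prop
        rw [lintegral_const_mul _ (this.enorm.measurable.pow_const 2),
          lintegral_add_right_eq_self fun x => ‖fderiv ℝ φ x‖ₑ ^ 2]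
    _ = ‖h‖ₑ ^ 2 * ∫⁻ x, ‖fderiv ℝ φ x‖ₑ ^ 2 := by simp

/-- Normalised Lebesgue measure on the ball of radius `r` about the origin. -/
noncomputable def ballMeasure (r : ℝ) : Measure Plane :=
  (volume (Metric.ball (0 : Plane) r))⁻¹ • volume.restrict (Metric.ball 0 r)

theorem isProbabilityMeasure_ballMeasure {r : ℝ} (hr : 0 < r) :
    IsProbabilityMeasure (ballMeasure r) := by
  constructor
  rw [ballMeasure, Measure.smul_apply, Measure.restrict_apply_univ, smul_eq_mul]
  exact ENNReal.inv_mul_cancel (Metric.measure_ball_pos _ _ hr).ne' measure_ball_lt_top.ne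

/-- A smooth function differs in `L²` from its averages over balls of radius `r` by at most
`r ‖∇φ‖`. -/
theorem lintegral_sub_ballAverage_sq_le {φ : Plane → ℂ} (hφ : ContDiff ℝ ∞ φ) {r : ℝ}
    (hr : 0 < r) (hint : ∀ x, Integrable (fun y => φ (x + y)) (ballMeasure r)) :
    ∫⁻ x, ‖∫ y, φ (x + y) ∂(ballMeasure r) - φ x‖ₑ ^ 2
      ≤ ENNReal.ofReal r ^ 2 * ∫⁻ x, ‖fderiv ℝ φ x‖ₑ ^ 2 := by
  have := isProbabilityMeasure_ballMeasure hr
  have hc := hφ.continuous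
  calc ∫⁻ x, ‖∫ y, φ (x + y) ∂(ballMeasure r) - φ x‖ₑ ^ 2
      ≤ ∫⁻ x, ∫⁻ y, ‖φ (x + y) - φ x‖ₑ ^ 2 ∂(ballMeasure r) := by
        refine lintegral_mono fun x => ?_
        have h1 : ∫ y, φ (x + y) ∂(ballMeasure r) - φ x
            = ∫ y, (φ (x + y) - φ x) ∂(ballMeasure r) := by
          rw [integral_sub (hint x) (integrable_const _)]
          simp
        rw [h1]
        exact enorm_integral_sq_le _ (by fun_prop : Continuous _).aestronglyMeasurable
    _ = ∫⁻ y, ∫⁻ x, ‖φ (x + y) - φ x‖ₑ ^ 2 ∂volume ∂(ballMeasure r) := by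
        refine lintegral_lintegral_swap ?_
        have : Continuous fun p : Plane × Plane => φ (p.1 + p.2) - φ p.1 := by fun_prop
        exact (this.enorm.measurable.pow_const 2).aemeasurable
    _ ≤ ∫⁻ _y, (ENNReal.ofReal r ^ 2 * ∫⁻ x, ‖fderiv ℝ φ x‖ₑ ^ 2) ∂(ballMeasure r) := by
        refine lintegral_mono_ae ?_
        have h2 : ∀ᵐ y ∂(ballMeasure r), y ∈ Metric.ball (0 : Plane) r :=
          Measure.ae_smul_measure (ae_restrict_mem Metric.isOpen_ball.measurableSet) _
        filter_upwards [h2] with y hy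
        refine (lintegral_translate_sub_sq_le hφ y).trans ?_
        gcongr
        rw [← ofReal_norm]
        exact ENNReal.ofReal_le_ofReal (mem_ball_zero_iff.1 hy).le
    _ = ENNReal.ofReal r ^ 2 * ∫⁻ x, ‖fderiv ℝ φ x‖ₑ ^ 2 := by simp

theorem enorm_fderiv_sq_le (φ : Plane → ℂ) (x : Plane) :
    ‖fderiv ℝ φ x‖ₑ ^ 2 ≤ 2 * ∑ i, ‖partialDeriv i φ x‖ₑ ^ 2 := by
  have h1 : ‖fderiv ℝ φ x‖ ≤ ∑ i, ‖partialDeriv i φ x‖ := by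
    refine ContinuousLinearMap.opNorm_le_bound _ (by positivity) fun v => ?_
    have h2 : v = ∑ i, v i • EuclideanSpace.single i (1 : ℝ) := by
      ext j
      fin_cases j <;> simp [Fin.sum_univ_two]
    calc ‖fderiv ℝ φ x v‖ = ‖∑ i, v i • partialDeriv i φ x‖ := by
          conv_lhs => rw [h2]
          simp only [map_sum, map_smul, partialDeriv]
      _ ≤ ∑ i, ‖v‖ * ‖partialDeriv i φ x‖ := by
          refine norm_sum_le_of_le _ fun i _ => ?_
          rw [norm_smul]
          gcongr
          exact PiLp.norm_apply_le v i
      _ = (∑ i, ‖partialDeriv i φ x‖) * ‖v‖ := by rw [← Finset.mul_sum, mul_comm]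
  have h3 : ‖fderiv ℝ φ x‖ ^ 2 ≤ 2 * ∑ i, ‖partialDeriv i φ x‖ ^ 2 := by
    rw [Fin.sum_univ_two] at h1 ⊢
    nlinarith [sq_nonneg (‖partialDeriv 0 φ x‖ - ‖partialDeriv 1 φ x‖), norm_nonneg (fderiv ℝ φ x)]
  have h4 := ENNReal.ofReal_le_ofReal h3
  rw [ENNReal.ofReal_mul zero_le_two, ENNReal.ofReal_sum_of_nonneg fun _ _ => by positivity] at h4
  simpa [ENNReal.ofReal_pow, ofReal_norm] using h4

/-- An element of `H¹(Ω)` represented by a test function is controlled in `L²` by its averages over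
balls of radius `r`, up to an error of order `r` relative to its `H¹` norm. -/
theorem norm_sq_toL2_le_ballAverage (hΩ : IsOpen Ω) (hb : Bornology.IsBounded Ω) {w : H1 Ω}
    {φ : Plane → ℂ} (hφ : IsTestFunction Ω φ) (hw : H1.toL2 w =ᵐ[volume.restrict Ω] φ) {r : ℝ}
    (hr : 0 < r) :
    ENNReal.ofReal (‖H1.toL2 w‖ ^ 2) ≤
      2 * (∫⁻ x in Ω, ‖∫ y, φ (x + y) ∂(ballMeasure r)‖ₑ ^ 2)
        + ENNReal.ofReal (4 * r ^ 2 * ‖w‖ ^ 2) := by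
  have := isProbabilityMeasure_ballMeasure hr
  have hc := hφ.contDiff.continuous
  have hint : ∀ x, Integrable (fun y => φ (x + y)) (ballMeasure r) := fun x => by
    obtain ⟨C, hC⟩ := hφ.hasCompactSupport.exists_bound_of_continuous hc
    exact Integrable.of_bound (by fun_prop : Continuous _).aestronglyMeasurable C
      (ae_of_all _ fun y => hC _)
  have hgrad : ∫⁻ x, ‖fderiv ℝ φ x‖ₑ ^ 2 ≤ ENNReal.ofReal (2 * ‖w‖ ^ 2) := by
    have hwφ := H1.eq_ofSmooth hΩ hb hφ.contDiff hw
    have h1 : ∫⁻ x, ‖fderiv ℝ φ x‖ₑ ^ 2 = ∫⁻ x in Ω, ‖fderiv ℝ φ x‖ₑ ^ 2 := by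
      refine (setLIntegral_eq_of_support_subset ?_).symm
      intro x hx
      by_contra hxΩ
      refine hx ?_
      have : x ∉ tsupport (fderiv ℝ φ) := fun h =>
        hxΩ (hφ.tsupport_subset (tsupport_fderiv_subset ℝ h))
      simp [image_eq_zero_of_notMem_tsupport this, ← ofReal_norm]
    have h2 : ∀ i, ∫⁻ x in Ω, ‖partialDeriv i φ x‖ₑ ^ 2 = ENNReal.ofReal (‖H1.grad w i‖ ^ 2) := by
      intro i
      rw [← lintegral_enorm_sq_eq, hwφ]
      refine lintegral_congr_ae ?_
      filter_upwards [H1.grad_ofSmooth hb hφ.contDiff i] with x hx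
      rw [hx]
    have hm : ∀ i, Measurable fun x => ‖partialDeriv i φ x‖ₑ ^ 2 := fun i =>
      (continuous_partialDeriv hφ.contDiff i).enorm.measurable.pow_const 2
    calc ∫⁻ x, ‖fderiv ℝ φ x‖ₑ ^ 2 = ∫⁻ x in Ω, ‖fderiv ℝ φ x‖ₑ ^ 2 := h1
      _ ≤ ∫⁻ x in Ω, 2 * ∑ i, ‖partialDeriv i φ x‖ₑ ^ 2 :=
        lintegral_mono fun x => enorm_fderiv_sq_le φ x
      _ = 2 * ∑ i, ENNReal.ofReal (‖H1.grad w i‖ ^ 2) := by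
        rw [lintegral_const_mul _ (Finset.measurable_fun_sum _ fun i _ => hm i),
          lintegral_finsetSum _ fun i _ => hm i]
        simp only [h2]
      _ = ENNReal.ofReal (2 * ∑ i, ‖H1.grad w i‖ ^ 2) := by
        rw [ENNReal.ofReal_mul zero_le_two, ENNReal.ofReal_sum_of_nonneg fun _ _ => by positivity]
        simp
      _ ≤ ENNReal.ofReal (2 * ‖w‖ ^ 2) := by
        refine ENNReal.ofReal_le_ofReal ?_
        nlinarith [H1.norm_sq w, sq_nonneg ‖H1.toL2 w‖]
  have hdefect := (setLIntegral_le_lintegral Ω _).trans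
    (lintegral_sub_ballAverage_sq_le hφ.contDiff hr hint)
  have hpt : ∀ a b : ℂ, ‖b‖ₑ ^ 2 ≤ 2 * ‖a‖ₑ ^ 2 + 2 * ‖a - b‖ₑ ^ 2 := fun a b => by
    have h1 : ‖b‖ ^ 2 ≤ 2 * ‖a‖ ^ 2 + 2 * ‖a - b‖ ^ 2 := by
      have h2 : ‖b‖ ≤ ‖a‖ + ‖a - b‖ := by
        rw [norm_sub_rev, add_comm]
        exact norm_le_norm_sub_add b a
      nlinarith [sq_nonneg (‖a‖ - ‖a - b‖), norm_nonneg b]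
    have h4 := ENNReal.ofReal_le_ofReal h1
    rw [ENNReal.ofReal_add (by positivity) (by positivity), ENNReal.ofReal_mul zero_le_two,
      ENNReal.ofReal_mul zero_le_two] at h4
    simpa [ENNReal.ofReal_pow, ofReal_norm] using h4
  have hA : Measurable fun x => ∫ y, φ (x + y) ∂(ballMeasure r) := by
    have h1 : Continuous fun p : Plane × Plane => φ (p.1 + p.2) := by fun_prop
    exact h1.stronglyMeasurable.integral_prod_right.measurable
  have hD : Measurable fun x => ∫ y, φ (x + y) ∂(ballMeasure r) - φ x := hA.sub hc.measurable
  calc ENNReal.ofReal (‖H1.toL2 w‖ ^ 2) = ∫⁻ x in Ω, ‖φ x‖ₑ ^ 2 := by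
        rw [← lintegral_enorm_sq_eq]
        refine lintegral_congr_ae ?_
        filter_upwards [hw] with x hx
        rw [hx]
    _ ≤ ∫⁻ x in Ω, (2 * ‖∫ y, φ (x + y) ∂(ballMeasure r)‖ₑ ^ 2
          + 2 * ‖∫ y, φ (x + y) ∂(ballMeasure r) - φ x‖ₑ ^ 2) := lintegral_mono fun x => hpt _ _
    _ = 2 * (∫⁻ x in Ω, ‖∫ y, φ (x + y) ∂(ballMeasure r)‖ₑ ^ 2)
          + 2 * ∫⁻ x in Ω, ‖∫ y, φ (x + y) ∂(ballMeasure r) - φ x‖ₑ ^ 2 := by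
        rw [lintegral_add_left ((hA.enorm.pow_const 2).const_mul _),
          lintegral_const_mul _ (hA.enorm.pow_const 2),
          lintegral_const_mul _ (hD.enorm.pow_const 2)]
    _ ≤ 2 * (∫⁻ x in Ω, ‖∫ y, φ (x + y) ∂(ballMeasure r)‖ₑ ^ 2)
          + 2 * (ENNReal.ofReal r ^ 2 * ENNReal.ofReal (2 * ‖w‖ ^ 2)) := by
        gcongr
        exact hdefect.trans (by gcongr)
    _ = _ := by
        rw [← ENNReal.ofReal_pow hr.le, ← ENNReal.ofReal_mul (by positivity),
          show 4 * r ^ 2 * ‖w‖ ^ 2 = 2 * (r ^ 2 * (2 * ‖w‖ ^ 2)) by ring,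
          ENNReal.ofReal_mul zero_le_two, ENNReal.ofReal_ofNat]

/-- Compactness for sequences of test functions: if they are bounded in `H¹(Ω)` and their integrals
over measurable sets tend to zero, they tend to zero in `L²`. The averages over balls of a fixed
radius tend to zero boundedly, and they are uniformly close to the functions themselves. -/
theorem tendsto_toL2_zero_of_testFunction (hΩ : IsOpen Ω) (hb : Bornology.IsBounded Ω)
    {w : ℕ → H1 Ω} (hw : ∀ k, w k ∈ testSubmodule Ω) {M : ℝ} (hM : ∀ k, ‖w k‖ ≤ M)
    (hweak : ∀ s : Set Plane, MeasurableSet s →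
      Tendsto (fun k => ∫ x in s, H1.toL2 (w k) x ∂(volume.restrict Ω)) atTop (𝓝 0)) :
    Tendsto (fun k => H1.toL2 (w k)) atTop (𝓝 0) := by
  have hfin : IsFiniteMeasure (volume.restrict Ω) := ⟨by simpa using hb.measure_lt_top⟩
  choose φ hφ hwφ using hw
  have hc : ∀ k, Continuous (φ k) := fun k => (hφ k).contDiff.continuous
  have hsupp : ∀ k x, x ∉ Ω → φ k x = 0 := fun k x hx =>
    image_eq_zero_of_notMem_tsupport fun h => hx ((hφ k).tsupport_subset h)
  -- integrals of `φ k` over balls are integrals of `w k` over measurable subsets of `Ω`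
  have hball : ∀ r x, Tendsto (fun k => ∫ y, φ k (x + y) ∂(ballMeasure r)) atTop (𝓝 0) := by
    intro r x
    have h1 := hweak (Metric.ball x r) Metric.isOpen_ball.measurableSet
    have h2 : ∀ k, ∫ y, φ k (x + y) ∂(ballMeasure r) =
        ((volume (Metric.ball (0 : Plane) r))⁻¹).toReal •
          ∫ z in Metric.ball x r, H1.toL2 (w k) z ∂(volume.restrict Ω) := by
      intro k
      rw [ballMeasure, integral_smul_measure]
      congr 1
      have h3 : ∫ z in Metric.ball x r, H1.toL2 (w k) z ∂(volume.restrict Ω)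
          = ∫ z in Metric.ball x r, φ k z := by
        rw [setIntegral_congr_ae (g := φ k) Metric.isOpen_ball.measurableSet
          ((hwφ k).mono fun z hz _ => hz),
          Measure.restrict_restrict Metric.isOpen_ball.measurableSet]
        refine setIntegral_eq_of_subset_of_forall_sdiff_eq_zero
          Metric.isOpen_ball.measurableSet inter_subset_left (fun z hz => ?_) |>.symm
        exact hsupp k z fun h => hz.2 ⟨hz.1, h⟩
      rw [h3, ← integral_indicator Metric.isOpen_ball.measurableSet,
        ← integral_indicator Metric.isOpen_ball.measurableSet,
        ← integral_add_left_eq_self ((Metric.ball x r).indicator (φ k)) x]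
      refine integral_congr_ae (ae_of_all _ fun y => ?_)
      simp only [indicator, mem_ball_iff_norm, add_sub_cancel_left, sub_zero]
    simp only [h2]
    simpa using h1.const_smul ((volume (Metric.ball (0 : Plane) r))⁻¹).toReal
  have havg : ∀ r, 0 < r → Tendsto (fun k => ∫⁻ x in Ω, ‖∫ y, φ k (x + y) ∂(ballMeasure r)‖ₑ ^ 2)
      atTop (𝓝 0) := by
    intro r hr
    have := isProbabilityMeasure_ballMeasure hr
    have h0 : Tendsto (fun k => ∫⁻ x in Ω, ‖∫ y, φ k (x + y) ∂(ballMeasure r)‖ₑ ^ 2)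
        atTop (𝓝 (∫⁻ _x in Ω, 0)) := by
      refine tendsto_lintegral_of_dominated_convergence (fun _ =>
        (volume (Metric.ball (0 : Plane) r))⁻¹ * ENNReal.ofReal (M ^ 2)) ?_ ?_ ?_ ?_
      · intro k
        have h1 : Continuous fun p : Plane × Plane => φ k (p.1 + p.2) := by
          have := hc k
          fun_prop
        exact h1.stronglyMeasurable.integral_prod_right.measurable.enorm.pow_const 2
      · refine fun k => ae_of_all _ fun x => ?_
        have hk := hc k
        refine (enorm_integral_sq_le _ (by fun_prop : Continuous _).aestronglyMeasurable).trans ?_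
        rw [ballMeasure, lintegral_smul_measure, smul_eq_mul]
        refine mul_le_mul_right ?_ _
        calc ∫⁻ y in Metric.ball 0 r, ‖φ k (x + y)‖ₑ ^ 2
            ≤ ∫⁻ y, ‖φ k (x + y)‖ₑ ^ 2 := setLIntegral_le_lintegral _ _
          _ = ∫⁻ y, ‖φ k y‖ₑ ^ 2 := lintegral_add_left_eq_self (fun y => ‖φ k y‖ₑ ^ 2) x
          _ = ∫⁻ y in Ω, ‖φ k y‖ₑ ^ 2 := by
            refine (setLIntegral_eq_of_support_subset fun y hy => ?_).symm
            by_contra h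
            exact hy (by simp [hsupp k y h])
          _ = ENNReal.ofReal (‖H1.toL2 (w k)‖ ^ 2) := by
            rw [← lintegral_enorm_sq_eq]
            refine lintegral_congr_ae ?_
            filter_upwards [hwφ k] with x hx
            rw [hx]
          _ ≤ ENNReal.ofReal (M ^ 2) := by
            have := (H1.norm_toL2_le (w k)).trans (hM k)
            exact ENNReal.ofReal_le_ofReal (pow_le_pow_left₀ (norm_nonneg _) this 2)
      · rw [lintegral_const]
        refine ENNReal.mul_ne_top (ENNReal.mul_ne_top ?_ ENNReal.ofReal_ne_top) (measure_ne_top _ _)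
        exact ENNReal.inv_ne_top.2 (Metric.measure_ball_pos _ _ hr).ne'
      · refine ae_of_all _ fun x => ?_
        have h1 := ((ENNReal.continuous_pow 2).comp continuous_enorm).tendsto (0 : ℂ)
        simpa [Function.comp_def] using h1.comp (hball r x)
    simpa using h0
  have hsq : Tendsto (fun k => ENNReal.ofReal (‖H1.toL2 (w k)‖ ^ 2)) atTop (𝓝 0) := by
    rw [ENNReal.tendsto_nhds_zero]
    intro ε hε
    -- a radius for which the defect is at most `ε / 2`
    obtain ⟨r, hr, hrε⟩ : ∃ r : ℝ, 0 < r ∧ ENNReal.ofReal (4 * r ^ 2 * M ^ 2) ≤ ε / 2 := by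
      have h1 : Tendsto (fun r : ℝ => ENNReal.ofReal (4 * r ^ 2 * M ^ 2)) (𝓝[>] 0) (𝓝 0) := by
        have h2 : Continuous fun r : ℝ => ENNReal.ofReal (4 * r ^ 2 * M ^ 2) :=
          ENNReal.continuous_ofReal.comp (by fun_prop)
        simpa using (h2.tendsto 0).mono_left nhdsWithin_le_nhds
      have h3 := (ENNReal.tendsto_nhds_zero.1 h1 (ε / 2) (ENNReal.half_pos hε.ne')).and
        self_mem_nhdsWithin
      obtain ⟨r, h4, h5⟩ := h3.exists
      exact ⟨r, h5, h4⟩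
    have h2 : Tendsto (fun k => 2 * (∫⁻ x in Ω, ‖∫ y, φ k (x + y) ∂(ballMeasure r)‖ₑ ^ 2))
        atTop (𝓝 0) := by
      simpa using ENNReal.Tendsto.const_mul (havg r hr) (Or.inr (by simp : (2 : ℝ≥0∞) ≠ ⊤))
    filter_upwards [ENNReal.tendsto_nhds_zero.1 h2 (ε / 2) (ENNReal.half_pos hε.ne')] with k hk
    refine (norm_sq_toL2_le_ballAverage hΩ hb (hφ k) (hwφ k) hr).trans ?_
    refine (add_le_add hk ((ENNReal.ofReal_le_ofReal ?_).trans hrε)).trans (ENNReal.add_halves ε).le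
    have := hM k
    gcongr
  have h1 := (ENNReal.continuousAt_toReal ENNReal.zero_ne_top).tendsto.comp hsq
  have h2 : Tendsto (fun k => ‖H1.toL2 (w k)‖ ^ 2) atTop (𝓝 0) := by
    refine (h1.congr fun k => ?_)
    simp
  rw [tendsto_zero_iff_norm_tendsto_zero]
  simpa [Function.comp_def] using (Real.continuous_sqrt.tendsto 0).comp h2

/-- The Rellich–Kondrachov theorem for `H¹₀(Ω)`: a sequence converging weakly to zero converges to
zero in `L²`. -/
theorem tendsto_toL2_zero_of_weak (hΩ : IsOpen Ω) (hb : Bornology.IsBounded Ω)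
    {w : ℕ → H1 Ω} (hw : ∀ k, w k ∈ H10sub Ω) {M : ℝ} (hM : ∀ k, ‖w k‖ ≤ M)
    (hweak : ∀ a : L2 Ω, Tendsto (fun k => inner ℂ a (H1.toL2 (w k))) atTop (𝓝 0)) :
    Tendsto (fun k => H1.toL2 (w k)) atTop (𝓝 0) := by
  have hfin : IsFiniteMeasure (volume.restrict Ω) := ⟨by simpa using hb.measure_lt_top⟩
  have happrox : ∀ k, ∃ v ∈ testSubmodule Ω, ‖w k - v‖ < 1 / ((k : ℝ) + 1) := fun k => by
    obtain ⟨v, hv, hd⟩ := Metric.mem_closure_iff.1 (hw k) _ (Nat.one_div_pos_of_nat (n := k))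
    exact ⟨v, hv, by rwa [dist_eq_norm] at hd⟩
  choose v hv hwv using happrox
  have hdiff : Tendsto (fun k => H1.toL2 (w k - v k)) atTop (𝓝 0) :=
    squeeze_zero_norm (fun k => (H1.norm_toL2_le _).trans (hwv k).le)
      tendsto_one_div_add_atTop_nhds_zero_nat
  have hvM : ∀ k, ‖v k‖ ≤ M + 1 := fun k => by
    have h1 : 1 / ((k : ℝ) + 1) ≤ 1 := by
      rw [div_le_one (by positivity)]
      simp
    have h2 := norm_le_norm_add_norm_sub (w k) (v k)
    linarith [hM k, hwv k]
  have hvlim := tendsto_toL2_zero_of_testFunction hΩ hb hv hvM fun s hs => by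
    have h1 : ∀ k, ∫ x in s, H1.toL2 (v k) x ∂(volume.restrict Ω) =
        inner ℂ (indicatorConstLp 2 hs (measure_ne_top (volume.restrict Ω) s) (1 : ℂ))
            (H1.toL2 (w k)) -
          inner ℂ (indicatorConstLp 2 hs (measure_ne_top (volume.restrict Ω) s) (1 : ℂ))
            (H1.toL2 (w k - v k)) := fun k => by
      rw [← inner_sub_right, H1.toL2_sub, sub_sub_cancel, L2.inner_indicatorConstLp_one]
    simp only [h1]
    set a := indicatorConstLp 2 hs (measure_ne_top (volume.restrict Ω) s) (1 : ℂ)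
    have h2 : Tendsto (fun k => inner ℂ a (H1.toL2 (w k - v k))) atTop (𝓝 (inner ℂ a 0)) :=
      tendsto_const_nhds.inner hdiff
    rw [inner_zero_right] at h2
    simpa using (hweak a).sub h2
  have := hdiff.add hvlim
  simpa [H1.toL2_sub] using this

/-! ### A finite-energy competitor with values in the sphere -/

/-- Radial projection from an interior point `a` of the ball of radius `R` onto its boundary
sphere: `y ≠ a` is sent to the point where the ray from `a` through `y` meets the sphere. -/
theorem exists_smooth_projection_to_sphere {F : Type*} [NormedAddCommGroup F]
    [InnerProductSpace ℝ F] {a : F} {R : ℝ} (ha : ‖a‖ < R) :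
    ∃ P : F → F, (∀ y, y ≠ a → ContDiffAt ℝ ∞ P y) ∧ (∀ y, y ≠ a → ‖P y‖ = R) ∧
      ∀ y, ‖y‖ = R → P y = y := by
  have hR : 0 < R := (norm_nonneg a).trans_lt ha
  have hgap : 0 < R ^ 2 - ‖a‖ ^ 2 := by nlinarith [norm_nonneg a]
  -- `a + t (y - a)` has norm `R` iff `A t² + 2 B t = D`, with these `A`, `B`, `D`
  set A : F → ℝ := fun y => ‖y - a‖ ^ 2
  set B : F → ℝ := fun y => inner ℝ a (y - a)
  set D : ℝ := R ^ 2 - ‖a‖ ^ 2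
  set t : F → ℝ := fun y => (-B y + √(B y ^ 2 + A y * D)) / A y
  have hApos : ∀ y, y ≠ a → 0 < A y := fun y hy => by
    have := norm_pos_iff.2 (sub_ne_zero.2 hy)
    positivity
  have hnorm : ∀ y (s : ℝ), ‖a + s • (y - a)‖ ^ 2 = ‖a‖ ^ 2 + 2 * B y * s + A y * s ^ 2 := by
    intro y s
    rw [norm_add_sq_real, real_inner_smul_right, norm_smul, mul_pow, Real.norm_eq_abs, sq_abs]
    ring
  refine ⟨fun y => a + t y • (y - a), ?_, ?_, ?_⟩
  · intro y hy
    have hA : ContDiff ℝ ∞ A := (contDiff_id.sub contDiff_const).norm_sq ℝ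
    have hB : ContDiff ℝ ∞ B := contDiff_const.inner ℝ (contDiff_id.sub contDiff_const)
    have hsqrt : ContDiffAt ℝ ∞ (fun y => √(B y ^ 2 + A y * D)) y := by
      refine ContDiffAt.sqrt ((hB.pow 2).add (hA.mul contDiff_const)).contDiffAt ?_
      have := mul_pos (hApos y hy) hgap
      positivity
    have ht : ContDiffAt ℝ ∞ t y :=
      (hB.neg.contDiffAt.add hsqrt).div hA.contDiffAt (hApos y hy).ne'
    exact contDiffAt_const.add (ht.smul (contDiffAt_id.sub contDiffAt_const))
  · intro y hy
    have h1 := mul_pos (hApos y hy) hgap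
    have h2 : √(B y ^ 2 + A y * D) ^ 2 = B y ^ 2 + A y * D := Real.sq_sqrt (by positivity)
    have h3 : A y * t y = -B y + √(B y ^ 2 + A y * D) := mul_div_cancel₀ _ (hApos y hy).ne'
    have h4 : A y * (2 * B y * t y + A y * t y ^ 2) = A y * D := by
      have h5 : A y * (2 * B y * t y + A y * t y ^ 2) = (A y * t y + B y) ^ 2 - B y ^ 2 := by ring
      rw [h5, h3]
      linear_combination h2
    have h6 := mul_left_cancel₀ (hApos y hy).ne' h4
    have h7 : ‖a + t y • (y - a)‖ ^ 2 = R ^ 2 := by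
      rw [hnorm, add_assoc, h6]
      ring
    exact (sq_eq_sq₀ (norm_nonneg _) hR.le).1 h7
  · intro y hy
    have hya : y ≠ a := by
      rintro rfl
      exact ha.ne hy
    have h1 := hnorm y 1
    rw [one_smul, add_sub_cancel, hy] at h1
    have h2 : A y + 2 * B y = D := by linear_combination -h1
    -- the sum `A + B` is the positive square root, since `2 (A + B) = A + D`
    have h3 : √(B y ^ 2 + A y * D) = A y + B y := by
      rw [show B y ^ 2 + A y * D = (A y + B y) ^ 2 by rw [← h2]; ring]
      refine Real.sqrt_sq ?_
      linarith [hApos y hya]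
    have h4 : t y = 1 := by
      simp only [t, h3]
      rw [neg_add_cancel_comm_assoc]
      exact div_self (hApos y hya).ne'
    simp only [h4, one_smul, add_sub_cancel]

/-- For `n ≥ 2` unimodular boundary data extend smoothly to maps `v₁, …, vₙ` of the plane with
`∑ |vⱼ|² = n`. The image of the plane under a smooth extension omits points of `ℂⁿ` arbitrarily
close to the origin, for reasons of dimension; project it radially from one of them. -/
theorem exists_smooth_extension_to_sphere {n : ℕ} (hn : 2 ≤ n) {S : Set Plane}
    {g : Fin n → Plane → ℂ} (hg : ∀ j, ∃ G, IsSmoothExtension S (g j) G)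
    (hnorm : ∀ j, ∀ x ∈ S, ‖g j x‖ = 1) :
    ∃ v : Fin n → Plane → ℂ, (∀ j, IsSmoothExtension S (g j) (v j)) ∧
      ∀ x, ∑ j, ‖v j x‖ ^ 2 = (n : ℝ) := by
  choose G hG using hg
  set Γ : Plane → EuclideanSpace ℂ (Fin n) := fun x => WithLp.toLp 2 fun j => G j x with hΓdef
  have hΓ : ContDiff ℝ ∞ Γ := contDiff_piLp' 2 fun j => (hG j).1
  have hdense : Dense (range Γ)ᶜ := by
    refine ContDiff.dense_compl_range_of_finrank_lt_finrank (hΓ.of_le (by simp)) ?_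
    rw [finrank_real_of_complex, finrank_euclideanSpace_fin, finrank_euclideanSpace_fin]
    omega
  have hn0 : (0 : ℝ) < √n := Real.sqrt_pos.2 (by exact_mod_cast (by omega : 0 < n))
  obtain ⟨a, ha, han⟩ := hdense.exists_dist_lt (0 : EuclideanSpace ℂ (Fin n)) hn0
  rw [dist_zero_left] at han
  have hne : ∀ x, Γ x ≠ a := fun x hx => ha ⟨x, hx⟩
  obtain ⟨P, hP1, hP2, hP3⟩ := exists_smooth_projection_to_sphere han
  have hPΓ : ContDiff ℝ ∞ fun x => P (Γ x) := by
    rw [contDiff_iff_contDiffAt]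
    exact fun x => (hP1 _ (hne x)).comp x hΓ.contDiffAt
  refine ⟨fun j x => P (Γ x) j, fun j => ⟨?_, ?_⟩, ?_⟩
  · exact (contDiff_piLp 2).1 hPΓ j
  · intro x hx
    have h1 : ‖Γ x‖ = √n := by
      rw [EuclideanSpace.norm_eq]
      congr 1
      simp only [hΓdef]
      rw [Finset.sum_congr rfl fun j _ => by rw [(hG j).2 hx, hnorm j x hx]]
      simp
    simp only [hP3 _ h1]
    exact (hG j).2 hx
  · intro x
    rw [← EuclideanSpace.norm_sq_eq, hP2 _ (hne x), Real.sq_sqrt (Nat.cast_nonneg n)]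

/-! ### Weak sequential compactness -/

/-- A bounded sequence in a separable Hilbert space has a weakly convergent subsequence. -/
theorem exists_subseq_tendsto_inner {H : Type*} [NormedAddCommGroup H] [InnerProductSpace ℂ H]
    [CompleteSpace H] [TopologicalSpace.SeparableSpace H] {x : ℕ → H} {M : ℝ}
    (hx : ∀ k, ‖x k‖ ≤ M) :
    ∃ s : ℕ → ℕ, StrictMono s ∧ ∃ y : H, ∀ a : H,
      Tendsto (fun k => inner ℂ (x (s k)) a) atTop (𝓝 (inner ℂ y a)) := by
  obtain ⟨ℓ, -, s, hs, hlim⟩ := WeakDual.isSeqCompact_closedBall ℂ H 0 M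
    (x := fun k => StrongDual.toWeakDual (InnerProductSpace.toDual ℂ H (x k)))
    (fun k => by simpa using hx k)
  refine ⟨s, hs, (InnerProductSpace.toDual ℂ H).symm (WeakDual.toStrongDual ℓ), fun a => ?_⟩
  rw [InnerProductSpace.toDual_symm_apply]
  exact ((WeakDual.eval_continuous a).tendsto ℓ).comp hlim

/-- A closed subspace is weakly sequentially closed. -/
theorem mem_of_tendsto_inner {H : Type*} [NormedAddCommGroup H] [InnerProductSpace ℂ H]
    [CompleteSpace H] {K : Submodule ℂ H} (hK : IsClosed (K : Set H)) {x : ℕ → H} {y : H}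
    (hx : ∀ k, x k ∈ K) (h : ∀ a, Tendsto (fun k => inner ℂ (x k) a) atTop (𝓝 (inner ℂ y a))) :
    y ∈ K := by
  have : CompleteSpace K := hK.completeSpace_coe
  rw [← K.orthogonal_orthogonal, Submodule.mem_orthogonal']
  intro a ha
  refine tendsto_nhds_unique (h a) (tendsto_const_nhds.congr fun k => ?_)
  exact (ha (x k) (hx k)).symm

/-- Finitely many sequences bounded in a closed subspace of a separable Hilbert space have a common
subsequence along which all converge weakly in the subspace. Weak convergence is stated for the
images under an arbitrary bounded operator into a second Hilbert space. -/
theorem exists_subseq_forall_tendsto_inner {H : Type u} [NormedAddCommGroup H]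
    [InnerProductSpace ℂ H] [CompleteSpace H] [SecondCountableTopology H] {n : ℕ}
    {V : Submodule ℂ H} (hV : IsClosed (V : Set H)) {x : ℕ → Fin n → H} (hxV : ∀ k j, x k j ∈ V)
    {M : ℝ} (hx : ∀ k j, ‖x k j‖ ≤ M) :
    ∃ s : ℕ → ℕ, StrictMono s ∧ ∃ y : Fin n → H, (∀ j, y j ∈ V) ∧
      ∀ j {K : Type u} [NormedAddCommGroup K] [InnerProductSpace ℂ K] [CompleteSpace K]
        (T : H →L[ℂ] K) (a : K),
        Tendsto (fun k => inner ℂ (T (x (s k) j)) a) atTop (𝓝 (inner ℂ (T (y j)) a)) := by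
  have hb : ∀ k, ‖(WithLp.toLp 2 (x k) : PiLp 2 fun _ : Fin n => H)‖ ≤ √(n * M ^ 2) := fun k => by
    rw [PiLp.norm_eq_of_L2]
    refine Real.sqrt_le_sqrt ?_
    calc ∑ j, ‖x k j‖ ^ 2 ≤ ∑ _j : Fin n, M ^ 2 := by
          gcongr with j
          exact hx k j
      _ = n * M ^ 2 := by simp
  obtain ⟨s, hs, y, hy⟩ := exists_subseq_tendsto_inner hb
  suffices key : ∀ j {K : Type u} [NormedAddCommGroup K] [InnerProductSpace ℂ K] [CompleteSpace K]
      (T : H →L[ℂ] K) (a : K),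
      Tendsto (fun k => inner ℂ (T (x (s k) j)) a) atTop (𝓝 (inner ℂ (T (y j)) a)) by
    exact ⟨s, hs, y, fun j => mem_of_tendsto_inner hV (fun k => hxV (s k) j)
      (key j (ContinuousLinearMap.id ℂ H)), key⟩
  intro j K _ _ _ T a
  have h := hy (ContinuousLinearMap.adjoint (T.comp (PiLp.proj 2 (fun _ : Fin n => H) j)) a)
  simp only [ContinuousLinearMap.adjoint_inner_right] at h
  exact h

variable {n : ℕ}

/-! ### Energies -/

/-- The Dirichlet energy `I` as a real number. -/
noncomputable def dirichlet (u : Fin n → H1 Ω) : ℝ := ∑ j, ∑ i, ‖H1.grad (u j) i‖ ^ 2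

theorem dirichlet_nonneg (u : Fin n → H1 Ω) : 0 ≤ dirichlet u := by
  unfold dirichlet
  positivity

theorem lintegral_grad_eq (u : Fin n → H1 Ω) :
    ∫⁻ x in Ω, ∑ j, ∑ i, ‖H1.grad (u j) i x‖ₑ ^ 2 = I u := by
  rw [lintegral_finsetSum']
  · rfl
  · intro j _
    exact Finset.aemeasurable_fun_sum _ fun i _ =>
      ((Lp.aestronglyMeasurable (H1.grad (u j) i)).enorm.pow_const 2)

theorem I_eq_ofReal_dirichlet (u : Fin n → H1 Ω) : I u = ENNReal.ofReal (dirichlet u) := by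
  unfold I dirichlet
  rw [ENNReal.ofReal_sum_of_nonneg fun _ _ => by positivity]
  refine Finset.sum_congr rfl fun j _ => ?_
  rw [ENNReal.ofReal_sum_of_nonneg fun _ _ => by positivity, lintegral_finsetSum']
  · exact Finset.sum_congr rfl fun i _ => lintegral_enorm_sq_eq _
  · exact fun i _ => ((Lp.aestronglyMeasurable (H1.grad (u j) i)).enorm.pow_const 2)

theorem aemeasurable_potential_integrand (u : Fin n → H1 Ω) :
    AEMeasurable (fun x => ENNReal.ofReal (((n : ℝ) - ∑ j, ‖H1.toL2 (u j) x‖ ^ 2) ^ 2))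
      (volume.restrict Ω) := by
  refine ENNReal.measurable_ofReal.comp_aemeasurable ((AEMeasurable.const_sub ?_ _).pow_const 2)
  exact Finset.aemeasurable_fun_sum _ fun j _ =>
    (Lp.aestronglyMeasurable (H1.toL2 (u j))).norm.aemeasurable.pow_const 2

theorem potential_eq_zero_iff (u : Fin n → H1 Ω) :
    potential u = 0 ↔ ∀ᵐ x ∂(volume.restrict Ω), ∑ j, ‖H1.toL2 (u j) x‖ ^ 2 = (n : ℝ) := by
  unfold potential
  rw [lintegral_eq_zero_iff' (aemeasurable_potential_integrand u)]
  refine eventually_congr (Eventually.of_forall fun x => ?_)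
  rw [Pi.zero_apply, ENNReal.ofReal_eq_zero, ← sub_eq_zero, ← neg_eq_zero, neg_sub]
  exact ⟨fun h => pow_eq_zero_iff two_ne_zero |>.1 (le_antisymm h (sq_nonneg _)),
    fun h => by rw [h]; simp⟩

/-- Comparison of a minimizer of `E_ε` with a competitor in `𝒳`, whose potential energy is zero. -/
theorem dirichlet_add_potential_le {g : Fin n → Plane → ℂ} {ε : ℝ} (hε : 0 < ε)
    {u v : Fin n → H1 Ω} (hu : IsMinimizer (E ε) (H1gProd Ω g) u) (hv : v ∈ X Ω g) :
    potential u ≠ ⊤ ∧ dirichlet u + (potential u).toReal / (2 * ε ^ 2) ≤ dirichlet v := by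
  have h1 := hu.2 v hv.1
  unfold E at h1
  rw [lintegral_grad_eq, lintegral_grad_eq, (potential_eq_zero_iff v).2 hv.2, mul_zero, add_zero,
    I_eq_ofReal_dirichlet, I_eq_ofReal_dirichlet, ← ENNReal.ofReal_mul (by norm_num),
    ← ENNReal.ofReal_mul (by norm_num)] at h1
  have hpos : 0 < 1 / (4 * ε ^ 2) := by positivity
  have htop : potential u ≠ ⊤ := by
    intro h
    rw [h, ENNReal.mul_top (by simpa using hpos), add_top] at h1
    exact ENNReal.ofReal_ne_top (top_le_iff.1 h1)
  refine ⟨htop, ?_⟩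
  rw [← ENNReal.ofReal_toReal htop, ← ENNReal.ofReal_mul hpos.le,
    ← ENNReal.ofReal_add (mul_nonneg (by norm_num) (dirichlet_nonneg u))
      (mul_nonneg hpos.le ENNReal.toReal_nonneg),
    ENNReal.ofReal_le_ofReal_iff (mul_nonneg (by norm_num) (dirichlet_nonneg v))] at h1
  have h2 : (potential u).toReal / (2 * ε ^ 2) = 2 * (1 / (4 * ε ^ 2) * (potential u).toReal) := by
    field_simp
    ring
  rw [h2]
  linarith

/-- The potential energy controls the `L²` norm on a set of finite measure. -/
theorem norm_toL2_sq_le (hb : Bornology.IsBounded Ω) {u : Fin n → H1 Ω} (hu : potential u ≠ ⊤)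
    (j : Fin n) :
    ‖H1.toL2 (u j)‖ ^ 2 ≤ (n + 1) * (volume Ω).toReal + (potential u).toReal := by
  have hΩ : volume Ω ≠ ⊤ := hb.measure_lt_top.ne
  have hpt : ∀ x, ‖H1.toL2 (u j) x‖ₑ ^ 2 ≤ ENNReal.ofReal (n + 1) +
      ENNReal.ofReal (((n : ℝ) - ∑ j, ‖H1.toL2 (u j) x‖ ^ 2) ^ 2) := fun x => by
    rw [← ofReal_norm, ← ENNReal.ofReal_pow (norm_nonneg _),
      ← ENNReal.ofReal_add (by positivity) (sq_nonneg _)]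
    refine ENNReal.ofReal_le_ofReal ?_
    have h1 : ‖H1.toL2 (u j) x‖ ^ 2 ≤ ∑ j, ‖H1.toL2 (u j) x‖ ^ 2 :=
      Finset.single_le_sum (f := fun j => ‖H1.toL2 (u j) x‖ ^ 2) (fun _ _ => sq_nonneg _)
        (Finset.mem_univ j)
    nlinarith [sq_nonneg ((n : ℝ) - ∑ j, ‖H1.toL2 (u j) x‖ ^ 2 + 1 / 2)]
  have h2 : ENNReal.ofReal (‖H1.toL2 (u j)‖ ^ 2) ≤
      ENNReal.ofReal (n + 1) * volume Ω + potential u := by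
    rw [← lintegral_enorm_sq_eq]
    refine (lintegral_mono hpt).trans ?_
    rw [lintegral_add_left measurable_const, lintegral_const, Measure.restrict_apply_univ]
    rfl
  have hn : (0 : ℝ) ≤ n + 1 := by positivity
  rw [← ENNReal.ofReal_toReal hΩ, ← ENNReal.ofReal_toReal hu, ← ENNReal.ofReal_mul hn,
    ← ENNReal.ofReal_add (by positivity) (by positivity),
    ENNReal.ofReal_le_ofReal_iff (by positivity)] at h2
  exact h2

theorem norm_le_of_dirichlet_le (hb : Bornology.IsBounded Ω) {u : Fin n → H1 Ω}
    (hu : potential u ≠ ⊤) {D P : ℝ} (hD : dirichlet u ≤ D) (hP : (potential u).toReal ≤ P)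
    (j : Fin n) : ‖u j‖ ≤ √((n + 1) * (volume Ω).toReal + P + D) := by
  refine Real.le_sqrt_of_sq_le ?_
  have h1 : ∑ i, ‖H1.grad (u j) i‖ ^ 2 ≤ dirichlet u :=
    Finset.single_le_sum (f := fun j => ∑ i, ‖H1.grad (u j) i‖ ^ 2) (fun _ _ => by positivity)
      (Finset.mem_univ j)
  rw [H1.norm_sq]
  linarith [norm_toL2_sq_le hb hu j]

/-- `𝒳` is not empty when `n ≥ 2`, whatever the degrees of the boundary data. -/
theorem X_nonempty (hn : 2 ≤ n) (hb : Bornology.IsBounded Ω) {g : Fin n → Plane → ℂ}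
    (hg : ∀ j, ∃ G, IsSmoothExtension (frontier Ω) (g j) G)
    (hnorm : ∀ j, ∀ x ∈ frontier Ω, ‖g j x‖ = 1) : (X Ω g).Nonempty := by
  obtain ⟨v, hv, hsum⟩ := exists_smooth_extension_to_sphere hn hg hnorm
  refine ⟨fun j => H1.ofSmooth hb (v j) (hv j).1, fun j => ⟨v j, hv j, 0, ?_, ?_⟩, ?_⟩
  · exact mem_H10sub.1 (zero_mem _)
  · filter_upwards [H1.toL2_ofSmooth hb (hv j).1, Lp.coeFn_zero ℂ 2 (volume.restrict Ω)]
      with x hx h0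
    rw [hx]
    have : H1.toL2 (0 : H1 Ω) x = 0 := h0
    rw [this, add_zero]
  · have h1 : ∀ᵐ x ∂(volume.restrict Ω), ∀ j, H1.toL2 (H1.ofSmooth hb (v j) (hv j).1) x = v j x :=
      ae_all_iff.2 fun j => H1.toL2_ofSmooth hb (hv j).1
    filter_upwards [h1] with x hx
    simp only [hx, hsum]

/-! ### Limits of sequences -/

/-- Finitely many sequences converging in `L²` have a common almost everywhere convergent
subsequence. -/
theorem exists_subseq_forall_ae_tendsto {α ι : Type*} [Finite ι] [MeasurableSpace α] {μ : Measure α}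
    {f : ι → ℕ → Lp ℂ 2 μ} {f₀ : ι → Lp ℂ 2 μ} (h : ∀ j, Tendsto (f j) atTop (𝓝 (f₀ j))) :
    ∃ s : ℕ → ℕ, StrictMono s ∧
      ∀ᵐ x ∂μ, ∀ j, Tendsto (fun k => f j (s k) x) atTop (𝓝 (f₀ j x)) := by
  classical
  have := Fintype.ofFinite ι
  have key : ∀ t : Finset ι, ∃ s : ℕ → ℕ, StrictMono s ∧
      ∀ j ∈ t, ∀ᵐ x ∂μ, Tendsto (fun k => f j (s k) x) atTop (𝓝 (f₀ j x)) := by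
    intro t
    induction t using Finset.induction_on with
    | empty => exact ⟨id, strictMono_id, by simp⟩
    | insert j t _ ih =>
      obtain ⟨s, hs, hst⟩ := ih
      obtain ⟨s', hs', hlim⟩ := (tendstoInMeasure_of_tendsto_Lp
        ((h j).comp hs.tendsto_atTop)).exists_seq_tendsto_ae
      refine ⟨s ∘ s', hs.comp hs', fun i hi => ?_⟩
      rcases Finset.mem_insert.1 hi with rfl | hi
      · exact hlim
      · filter_upwards [hst i hi] with x hx
        exact hx.comp hs'.tendsto_atTop
  obtain ⟨s, hs, hst⟩ := key Finset.univ
  exact ⟨s, hs, ae_all_iff.2 fun j => hst j (Finset.mem_univ j)⟩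

/-- The constraint `∑ |uⱼ|² = n` holds for an `L²` limit along which the potential energy tends to
zero, by Fatou's lemma. -/
theorem potential_eq_zero_of_tendsto {U : ℕ → Fin n → H1 Ω} {u : Fin n → H1 Ω}
    (hU : ∀ j, Tendsto (fun k => H1.toL2 (U k j)) atTop (𝓝 (H1.toL2 (u j))))
    (hpot : Tendsto (fun k => potential (U k)) atTop (𝓝 0)) : potential u = 0 := by
  obtain ⟨s, hs, hae⟩ := exists_subseq_forall_ae_tendsto (f := fun j k => H1.toL2 (U k j)) hU
  have h1 : potential u ≤ liminf (fun k => potential (U (s k))) atTop := by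
    refine le_trans (le_of_eq ?_)
      (lintegral_liminf_le' fun k => aemeasurable_potential_integrand (U (s k)))
    refine lintegral_congr_ae ?_
    filter_upwards [hae] with x hx
    refine (Tendsto.liminf_eq ?_).symm
    exact (ENNReal.continuous_ofReal.tendsto _).comp
      ((tendsto_const_nhds.sub (tendsto_finsetSum _ fun j _ => (hx j).norm.pow 2)).pow 2)
  have h2 : Tendsto (fun k => potential (U (s k))) atTop (𝓝 0) := hpot.comp hs.tendsto_atTop
  rw [h2.liminf_eq] at h1
  exact le_antisymm h1 zero_le

theorem secondCountableTopology_H1 (Ω : Set Plane) : SecondCountableTopology (H1 Ω) := by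
  have : Fact ((2 : ℝ≥0∞) ≠ ⊤) := ⟨by simp⟩
  have h1 : SecondCountableTopology (L2 Ω) := Lp.SecondCountableTopology
  have h2 : SecondCountableTopology (PiLp 2 fun _ : Fin 2 => L2 Ω) := inferInstance
  have h3 : SecondCountableTopology (Ambient Ω) := WithLp.secondCountableTopology 2 _ _
  exact TopologicalSpace.Subtype.secondCountableTopology _

/-- A sequence bounded in `H¹` with fixed boundary data has a subsequence which converges strongly
in `L²` and whose gradients converge weakly, to a limit with the same boundary data. -/
theorem exists_subseq_weak_limit (hΩ : IsOpen Ω) (hb : Bornology.IsBounded Ω)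
    {g : Fin n → Plane → ℂ} (hg : ∀ j, ∃ G, IsSmoothExtension (frontier Ω) (g j) G)
    {U : ℕ → Fin n → H1 Ω} (hU : ∀ k, U k ∈ H1gProd Ω g) {M : ℝ} (hM : ∀ k j, ‖U k j‖ ≤ M) :
    ∃ s : ℕ → ℕ, StrictMono s ∧ ∃ u ∈ H1gProd Ω g,
      (∀ j, Tendsto (fun k => H1.toL2 (U (s k) j)) atTop (𝓝 (H1.toL2 (u j)))) ∧
      ∀ j i (a : L2 Ω), Tendsto (fun k => inner ℂ (H1.grad (U (s k) j) i) a) atTop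
        (𝓝 (inner ℂ (H1.grad (u j) i) a)) := by
  choose G hG using hg
  have := secondCountableTopology_H1 Ω
  set γ : Fin n → H1 Ω := fun j => H1.ofSmooth hb (G j) (hG j).1
  set W : ℕ → Fin n → H1 Ω := fun k j => U k j - γ j
  have hWmem : ∀ k j, W k j ∈ H10sub Ω := fun k j => (mem_H1g_iff hΩ hb (hG j)).1 (hU k j)
  have hW : ∀ k j, ‖W k j‖ ≤ M + ∑ j, ‖γ j‖ := fun k j =>
    (norm_sub_le (U k j) (γ j)).trans (add_le_add (hM k j)
      (Finset.single_le_sum (f := fun j => ‖γ j‖) (fun _ _ => norm_nonneg _) (Finset.mem_univ j)))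
  obtain ⟨s, hs, y, hyV, hy⟩ := exists_subseq_forall_tendsto_inner (isClosed_H10sub Ω) hWmem hW
  refine ⟨s, hs, fun j => γ j + y j, fun j => ?_, fun j => ?_, fun j i a => ?_⟩
  · rw [mem_H1g_iff hΩ hb (hG j), add_sub_cancel_left]
    exact hyV j
  · have h1 : Tendsto (fun k => H1.toL2 (W (s k) j - y j)) atTop (𝓝 0) := by
      refine tendsto_toL2_zero_of_weak hΩ hb (fun k => sub_mem (hWmem (s k) j) (hyV j))
        (M := M + ∑ j, ‖γ j‖ + ‖y j‖)
        (fun k => (norm_sub_le _ _).trans (by gcongr; exact hW _ _)) (fun a => ?_)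
      have h2 := (hy j (H1.toL2L Ω) a).sub_const (inner ℂ (H1.toL2 (y j)) a)
      have h3 := (Complex.continuous_conj.tendsto _).comp h2
      rw [H1.toL2L_apply, sub_self, map_zero] at h3
      refine h3.congr fun k => ?_
      rw [Function.comp_apply, H1.toL2L_apply, ← inner_sub_left, ← H1.toL2_sub]
      exact inner_conj_symm _ _
    have h2 := h1.add_const (H1.toL2 (γ j + y j))
    rw [zero_add] at h2
    refine h2.congr fun k => ?_
    rw [← H1.toL2_add, sub_add_add_cancel, sub_add_cancel]
  · have h2 := (hy j (H1.gradL Ω i) a).const_add (inner ℂ (H1.grad (γ j) i) a)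
    have h3 : ∀ v : H1 Ω, inner ℂ (H1.grad (γ j) i) a + inner ℂ (H1.grad v i) a =
        inner ℂ (H1.grad (γ j + v) i) a := fun v => (inner_add_left _ _ _).symm
    have h4 : ∀ k, γ j + W (s k) j = U (s k) j := fun k => add_sub_cancel _ _
    simpa only [H1.gradL_apply, h3, h4] using h2

/-- If the gradients of `U k` converge weakly to that of `u` and do not exceed it in energy, then
they converge strongly. -/
theorem tendsto_grad_of_dirichlet_le {U : ℕ → Fin n → H1 Ω} {u : Fin n → H1 Ω}
    (hweak : ∀ j i (a : L2 Ω), Tendsto (fun k => inner ℂ (H1.grad (U k j) i) a) atTop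
      (𝓝 (inner ℂ (H1.grad (u j) i) a)))
    (hle : ∀ k, dirichlet (U k) ≤ dirichlet u) (j : Fin n) (i : Fin 2) :
    Tendsto (fun k => H1.grad (U k j) i) atTop (𝓝 (H1.grad (u j) i)) := by
  have h1 : ∀ k, ‖H1.grad (U k j) i - H1.grad (u j) i‖ ^ 2 ≤ 2 * dirichlet u -
      2 * ∑ j, ∑ i, RCLike.re (inner ℂ (H1.grad (U k j) i) (H1.grad (u j) i)) := fun k => by
    have h2 : ∑ j, ∑ i, ‖H1.grad (U k j) i - H1.grad (u j) i‖ ^ 2 = dirichlet (U k) -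
        2 * ∑ j, ∑ i, RCLike.re (inner ℂ (H1.grad (U k j) i) (H1.grad (u j) i)) + dirichlet u := by
      simp only [@norm_sub_sq ℂ, Finset.sum_add_distrib, Finset.sum_sub_distrib, Finset.mul_sum,
        dirichlet]
    have h3 : ‖H1.grad (U k j) i - H1.grad (u j) i‖ ^ 2 ≤
        ∑ j, ∑ i, ‖H1.grad (U k j) i - H1.grad (u j) i‖ ^ 2 :=
      (Finset.single_le_sum (f := fun i => ‖H1.grad (U k j) i - H1.grad (u j) i‖ ^ 2)
        (fun _ _ => sq_nonneg _) (Finset.mem_univ i)).trans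
      (Finset.single_le_sum (f := fun j => ∑ i, ‖H1.grad (U k j) i - H1.grad (u j) i‖ ^ 2)
        (fun _ _ => by positivity) (Finset.mem_univ j))
    linarith [hle k]
  have h4 : Tendsto (fun k => 2 * dirichlet u -
      2 * ∑ j, ∑ i, RCLike.re (inner ℂ (H1.grad (U k j) i) (H1.grad (u j) i))) atTop
      (𝓝 (2 * dirichlet u -
        2 * ∑ j, ∑ i, RCLike.re (inner ℂ (H1.grad (u j) i) (H1.grad (u j) i)))) :=
    tendsto_const_nhds.sub (tendsto_const_nhds.mul (tendsto_finsetSum _ fun j _ =>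
      tendsto_finsetSum _ fun i _ => (RCLike.continuous_re.tendsto _).comp (hweak j i _)))
  have h5 : ∑ j, ∑ i, RCLike.re (inner ℂ (H1.grad (u j) i) (H1.grad (u j) i)) = dirichlet u :=
    Finset.sum_congr rfl fun j _ => Finset.sum_congr rfl fun i _ =>
      inner_self_eq_norm_sq (𝕜 := ℂ) (H1.grad (u j) i)
  rw [h5, sub_self] at h4
  have h6 := squeeze_zero (fun k => sq_nonneg _) h1 h4
  rw [tendsto_iff_norm_sub_tendsto_zero]
  simpa [Function.comp_def] using (Real.continuous_sqrt.tendsto 0).comp h6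

/-- Along a subsequence the minimizers of `E_ε` converge strongly to a minimizer of `I` over `𝒳`,
and their potential energy is `o(ε²)`. -/
theorem exists_subseq_tendsto_minimizer (hn : 2 ≤ n) (hΩ : IsOpen Ω) (hb : Bornology.IsBounded Ω)
    {g : Fin n → Plane → ℂ} (hg : ∀ j, ∃ G, IsSmoothExtension (frontier Ω) (g j) G)
    (hnorm : ∀ j, ∀ x ∈ frontier Ω, ‖g j x‖ = 1) {ε : ℕ → ℝ} (hε : ∀ k, 0 < ε k)
    (hε0 : Tendsto ε atTop (𝓝 0)) {U : ℕ → Fin n → H1 Ω}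
    (hU : ∀ k, IsMinimizer (E (ε k)) (H1gProd Ω g) (U k)) :
    ∃ s : ℕ → ℕ, StrictMono s ∧ ∃ u : Fin n → H1 Ω, IsMinimizer I (X Ω g) u ∧
      Tendsto (fun k => U (s k)) atTop (𝓝 u) ∧
      Tendsto (fun k => ENNReal.ofReal (1 / ε (s k) ^ 2) * potential (U (s k))) atTop (𝓝 0) := by
  obtain ⟨v, hv⟩ := X_nonempty hn hb hg hnorm
  have hcomp := fun k => fun v' hv' =>
    (dirichlet_add_potential_le (v := v') (hε k) (hU k) hv').2
  have htop : ∀ k, potential (U k) ≠ ⊤ := fun k =>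
    (dirichlet_add_potential_le (hε k) (hU k) hv).1
  have hquot : ∀ k, 0 ≤ (potential (U k)).toReal / (2 * ε k ^ 2) := fun k => by positivity
  have hD : ∀ k, ∀ v' ∈ X Ω g, dirichlet (U k) ≤ dirichlet v' := fun k v' hv' => by
    linarith [hcomp k v' hv', hquot k]
  have hP : ∀ k, (potential (U k)).toReal ≤ dirichlet v * (2 * ε k ^ 2) := fun k => by
    have h1 : (potential (U k)).toReal / (2 * ε k ^ 2) ≤ dirichlet v := by
      linarith [hcomp k v hv, dirichlet_nonneg (U k)]
    have := hε k
    rwa [div_le_iff₀ (by positivity)] at h1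
  have hPlim : Tendsto (fun k => dirichlet v * (2 * ε k ^ 2)) atTop (𝓝 0) := by
    simpa using ((hε0.pow 2).const_mul 2).const_mul (dirichlet v)
  obtain ⟨B, hB⟩ := hPlim.bddAbove_range
  obtain ⟨s, hs, u, hu, hL2, hweak⟩ := exists_subseq_weak_limit hΩ hb hg (fun k => (hU k).1)
    fun k j => norm_le_of_dirichlet_le hb (htop k) (hD k v hv)
      ((hP k).trans (hB (mem_range_self k))) j
  have hpot : Tendsto (fun k => potential (U (s k))) atTop (𝓝 0) := by
    have h1 : Tendsto (fun k => (potential (U k)).toReal) atTop (𝓝 0) :=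
      squeeze_zero (fun _ => ENNReal.toReal_nonneg) hP hPlim
    have h2 := (ENNReal.continuous_ofReal.tendsto 0).comp (h1.comp hs.tendsto_atTop)
    simpa [Function.comp_def, ENNReal.ofReal_toReal (htop _)] using h2
  have huX : u ∈ X Ω g :=
    ⟨hu, (potential_eq_zero_iff u).1 (potential_eq_zero_of_tendsto hL2 hpot)⟩
  have hgrad := tendsto_grad_of_dirichlet_le hweak fun k => hD (s k) u huX
  have hdir : Tendsto (fun k => dirichlet (U (s k))) atTop (𝓝 (dirichlet u)) :=
    tendsto_finsetSum _ fun j _ => tendsto_finsetSum _ fun i _ => (hgrad j i).norm.pow 2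
  refine ⟨s, hs, u, ⟨huX, fun v' hv' => ?_⟩, ?_, ?_⟩
  · rw [I_eq_ofReal_dirichlet, I_eq_ofReal_dirichlet]
    exact ENNReal.ofReal_le_ofReal (le_of_tendsto' hdir fun k => hD (s k) v' hv')
  · exact tendsto_pi_nhds.2 fun j => H1.tendsto_iff.2 ⟨hL2 j, hgrad j⟩
  · have h1 : Tendsto (fun k => (potential (U (s k))).toReal / (2 * ε (s k) ^ 2)) atTop (𝓝 0) := by
      refine squeeze_zero (fun k => hquot (s k))
        (fun k => by linarith [hcomp (s k) u huX] :
          ∀ k, _ ≤ dirichlet u - dirichlet (U (s k))) ?_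
      simpa using hdir.const_sub (dirichlet u)
    have h2 := (ENNReal.continuous_ofReal.tendsto _).comp (h1.const_mul 2)
    rw [mul_zero, ENNReal.ofReal_zero] at h2
    refine h2.congr fun k => ?_
    have := hε (s k)
    rw [Function.comp_apply, show 2 * ((potential (U (s k))).toReal / (2 * ε (s k) ^ 2)) =
      1 / ε (s k) ^ 2 * (potential (U (s k))).toReal by field_simp,
      ENNReal.ofReal_mul (by positivity), ENNReal.ofReal_toReal (htop _)]

end GinzburgLandau

theorem mainTheorem4 (n : ℕ) (hn : 2 ≤ n) (Ω : Set GinzburgLandau.Plane)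
    (hΩ_open : IsOpen Ω) (hΩ_bdd : Bornology.IsBounded Ω) (hΩ_sc : IsSimplyConnected Ω)
    (hΩ_smooth : GinzburgLandau.HasSmoothBoundary Ω)
    (g : Fin n → GinzburgLandau.Plane → ℂ)
    (hg_smooth : ∀ j, ∃ G, GinzburgLandau.IsSmoothExtension (frontier Ω) (g j) G)
    (hg_norm : ∀ j, ∀ x ∈ frontier Ω, ‖g j x‖ = 1)
    (u : ℝ → Fin n → GinzburgLandau.H1 Ω)
    (hu : ∀ ε : ℝ, 0 < ε → GinzburgLandau.IsMinimizer (GinzburgLandau.E ε)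
      (GinzburgLandau.H1gProd Ω g) (u ε)) :
    (∀ ε : ℕ → ℝ, (∀ k, 0 < ε k) → Tendsto ε atTop (𝓝 0) →
      ∃ s : ℕ → ℕ, StrictMono s ∧ ∃ uStar : Fin n → GinzburgLandau.H1 Ω,
        GinzburgLandau.IsMinimizer GinzburgLandau.I (GinzburgLandau.X Ω g) uStar ∧
        Tendsto (fun k => u (ε (s k))) atTop (𝓝 uStar)) ∧
    Tendsto (fun ε : ℝ => ENNReal.ofReal (1 / ε ^ 2) * GinzburgLandau.potential (u ε))
      (𝓝[>] 0) (𝓝 0) := by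
  refine ⟨fun ε hε hε0 => ?_, ?_⟩
  · obtain ⟨s, hs, v, hv, hlim, -⟩ := GinzburgLandau.exists_subseq_tendsto_minimizer hn hΩ_open
      hΩ_bdd hg_smooth hg_norm hε hε0 fun k => hu (ε k) (hε k)
    exact ⟨s, hs, v, hv, hlim⟩
  · refine tendsto_of_subseq_tendsto fun ε hε => ?_
    rw [tendsto_nhdsWithin_iff] at hε
    obtain ⟨N, hN⟩ := eventually_atTop.1 hε.2
    have hpos : ∀ k, 0 < ε (k + N) := fun k => hN (k + N) (Nat.le_add_left N k)
    obtain ⟨s, -, -, -, -, hlim⟩ := GinzburgLandau.exists_subseq_tendsto_minimizer hn hΩ_open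
      hΩ_bdd hg_smooth hg_norm hpos (hε.1.comp (tendsto_add_atTop_nat N))
      fun k => hu (ε (k + N)) (hpos k)
    exact ⟨fun k => s k + N, hlim⟩
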